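/- A seller has $m$ items for sale to $n$ buyers. Buyer $i$ has a non-negative value $v_{ij}$ for item $j$ and his value for a set $S$ of items is $\sum_{j\in S} v_{ij}$ (additive buyers). The values $v_{ij}$ are independent, $v_{ij}$ is drawn from a probability distribution $D_{ij}$ on $[0,\infty)$, and $D=\prod_{i,j} D_{ij}$. A (direct) mechanism maps reported values to a random set of items and a payment for each buyer; it is supply-feasible if, with probability one, every item is allocated to at most one buyer. Buyers have quasi-linear utilities and are risk neutral. Let $\mathrm{Rev}(D)$ be the supremum of the expected total payment at truthful reports over all supply-feasible mechanisms, with payments of finite expectation, that are Bayesian incentive compatible and interim individually rational, and assume $\mathrm{Rev}(D)<\infty$. A sequential two-part tariff is given by an ordering of the buyers, an entry fee $\pi_i\ge 0$ for every buyer $i$ and prices $p_{ij}\ge 0$. Each buyer first decides, knowing his own values but not which items will be left at his turn, whether to participate and pay $\pi_i$; he participates if and only if his expected utility from doing so is non-negative. Then the buyers are considered in the given order, and every participating buyer $i$ buys, among the items not yet sold, his favorite set at the prices $p_{ij}$, that is, the items $j$ left with $v_{ij}\ge p_{ij}$. Buyers who do not participate get nothing and pay nothing. Theorem. For every such product distribution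 $D$ there exists a supply-feasible sequential two-part tariff mechanism $\mathcal{M}$ whose expected revenue $\mathrm{Rev}_{\mathcal M}(D)$ satisfies $$\mathrm{Rev}(D)\le 28\,\mathrm{Rev}_{\mathcal M}(D).$$ -/

import Mathlib

open MeasureTheory

noncomputable section

namespace Auction

/-- A value for every buyer `i` and every item `j`: `v i j`. -/
abbrev ValueProfile (n m : ℕ) := Fin n → Fin m → ℝ

/-- The joint distribution of all values: `v i j` has law `D i j`, and all values are
independent. -/
def jointLaw {n m : ℕ} (D : Fin n → Fin m → Measure ℝ) : Measure (ValueProfile n m) :=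
  Measure.pi fun i => Measure.pi (D i)

/-- The types of buyer `i`: the value vectors in the support of `∏ j, D i j`. -/
def typeSpace {n m : ℕ} (D : Fin n → Fin m → Measure ℝ) (i : Fin n) : Set (Fin m → ℝ) :=
  {t | ∀ j, t j ∈ (D i j).support}

/-- A direct mechanism maps the reported values to a random allocation (a distribution over
tuples consisting of one set of items per buyer) and to a payment for every buyer (its
expectation over the coins of the mechanism). Buyers are additive, so every set of items is
demand-feasible for every buyer. -/
structure Mechanism (n m : ℕ) where
  alloc : ValueProfile n m → PMF (Fin n → Finset (Fin m))
  pay : ValueProfile n m → Fin n → ℝ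

namespace Mechanism

variable {n m : ℕ}

/-- Every item is allocated to at most one buyer, with probability one. -/
def SupplyFeasible (M : Mechanism n m) : Prop :=
  ∀ v, ∀ a ∈ (M.alloc v).support, ∀ i₁ i₂, i₁ ≠ i₂ → Disjoint (a i₁) (a i₂)

/-- The probability that buyer `i` receives item `j` at the reports `v`. -/
def allocProb (M : Mechanism n m) (v : ValueProfile n m) (i : Fin n) (j : Fin m) : ℝ :=
  ∑ a : Fin n → Finset (Fin m), if j ∈ a i then (M.alloc v a).toReal else 0

/-- The probability that buyer `i` receives item `j` when he reports `r` and the other buyers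
report their true values (replacing the `i`-th vector by `r` integrates out only the values of
the other buyers). -/
def interimAlloc (M : Mechanism n m) (D : Fin n → Fin m → Measure ℝ) (i : Fin n)
    (r : Fin m → ℝ) (j : Fin m) : ℝ :=
  ∫ v, M.allocProb (Function.update v i r) i j ∂jointLaw D

/-- The expected payment of buyer `i` when he reports `r` and the others are truthful. -/
def interimPay (M : Mechanism n m) (D : Fin n → Fin m → Measure ℝ) (i : Fin n)
    (r : Fin m → ℝ) : ℝ :=
  ∫ v, M.pay (Function.update v i r) i ∂jointLaw D

/-- The expected utility of buyer `i` with true values `t` when he reports `r` and the others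
are truthful. -/
def interimUtility (M : Mechanism n m) (D : Fin n → Fin m → Measure ℝ) (i : Fin n)
    (t r : Fin m → ℝ) : ℝ :=
  ∑ j, M.interimAlloc D i r j * t j - M.interimPay D i r

/-- The allocation probabilities and payments are measurable, and the payments have finite
expectation, both over all values and for every buyer and every report of his. -/
structure WellDefined (M : Mechanism n m) (D : Fin n → Fin m → Measure ℝ) : Prop where
  measurable_alloc : ∀ i j, Measurable fun v => M.allocProb v i j
  measurable_pay : ∀ i, Measurable fun v => M.pay v i
  integrable_pay : ∀ i, Integrable (fun v => M.pay v i) (jointLaw D)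
  integrable_interim : ∀ i, ∀ r ∈ typeSpace D i,
    Integrable (fun v => M.pay (Function.update v i r) i) (jointLaw D)

/-- Bayesian incentive compatibility: truthful reporting is a Bayes-Nash equilibrium. -/
def BIC (M : Mechanism n m) (D : Fin n → Fin m → Measure ℝ) : Prop :=
  ∀ i, ∀ t ∈ typeSpace D i, ∀ r ∈ typeSpace D i,
    M.interimUtility D i t r ≤ M.interimUtility D i t t

/-- Interim individual rationality: in the truthful equilibrium every type has a non-negative
expected utility. -/
def InterimIR (M : Mechanism n m) (D : Fin n → Fin m → Measure ℝ) : Prop :=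
  ∀ i, ∀ t ∈ typeSpace D i, 0 ≤ M.interimUtility D i t t

/-- The expected revenue (at truthful reports). -/
def revenue (M : Mechanism n m) (D : Fin n → Fin m → Measure ℝ) : ℝ :=
  ∫ v, ∑ i, M.pay v i ∂jointLaw D

end Mechanism

/-- The optimal revenue from additive buyers: the supremum of the expected revenue over all
supply-feasible, Bayesian incentive compatible, interim individually rational mechanisms. -/
def optRevenue {n m : ℕ} (D : Fin n → Fin m → Measure ℝ) : EReal :=
  ⨆ (M : Mechanism n m)
    (_ : M.WellDefined D ∧ M.SupplyFeasible ∧ M.BIC D ∧ M.InterimIR D),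
    ((M.revenue D : ℝ) : EReal)

/-- The parameters of a sequential two-part tariff: the order in which buyers are served
(`order k` is the buyer served at position `k`), an entry fee for every buyer, and a price for
every buyer and item. -/
structure SeqTwoPartTariff (n m : ℕ) where
  order : Equiv.Perm (Fin n)
  fee : Fin n → ℝ
  price : Fin n → Fin m → ℝ
  fee_nonneg : ∀ i, 0 ≤ fee i
  price_nonneg : ∀ i j, 0 ≤ price i j

namespace SeqTwoPartTariff

variable {n m : ℕ}

/-- The favorite set of buyer `i` with values `t` among the available items `A`: he buys
exactly the available items whose price does not exceed his value. -/
def favorite (T : SeqTwoPartTariff n m) (i : Fin n) (t : Fin m → ℝ) (A : Finset (Fin m)) :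
    Finset (Fin m) :=
  {j ∈ A | T.price i j ≤ t j}

/-- The favorite set maximizes the utility of the buyer over all sets of available items. -/
theorem sum_le_sum_favorite (T : SeqTwoPartTariff n m) (i : Fin n) (t : Fin m → ℝ)
    (A S : Finset (Fin m)) (hS : S ⊆ A) :
    ∑ j ∈ S, (t j - T.price i j) ≤ ∑ j ∈ T.favorite i t A, (t j - T.price i j) := by
  have h1 : ∑ j ∈ S, (t j - T.price i j)
      ≤ ∑ j ∈ S with T.price i j ≤ t j, (t j - T.price i j) := by
    rw [Finset.sum_filter]
    refine Finset.sum_le_sum fun j _ => ?_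
    split_ifs <;> linarith
  refine h1.trans (Finset.sum_le_sum_of_subset_of_nonneg ?_ ?_)
  · exact Finset.filter_subset_filter _ hS
  · intro j hj _
    have := (Finset.mem_filter.mp hj).2
    linarith

/-- The utility, before paying the entry fee, that buyer `i` with values `t` expects from
entering when the set of items available at his turn will be `avail w`, `w` being the still
unknown values. -/
def expectedGain (T : SeqTwoPartTariff n m) (D : Fin n → Fin m → Measure ℝ) (i : Fin n)
    (avail : ValueProfile n m → Finset (Fin m)) (t : Fin m → ℝ) : ℝ :=
  ∫ w, ∑ j ∈ T.favorite i t (avail w), (t j - T.price i j) ∂jointLaw D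

/-- Buyer `i` with values `t` pays the entry fee iff this gives a non-negative expected
utility; he decides without knowing which items will be available. -/
def Participates (T : SeqTwoPartTariff n m) (D : Fin n → Fin m → Measure ℝ) (i : Fin n)
    (avail : ValueProfile n m → Finset (Fin m)) (t : Fin m → ℝ) : Prop :=
  0 ≤ T.expectedGain D i avail t - T.fee i

open Classical in
/-- The set bought by buyer `i` at the values `v` when `avail v` is available at his turn. -/
def purchase (T : SeqTwoPartTariff n m) (D : Fin n → Fin m → Measure ℝ) (i : Fin n)
    (avail : ValueProfile n m → Finset (Fin m)) (v : ValueProfile n m) : Finset (Fin m) :=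
  if T.Participates D i avail (v i) then T.favorite i (v i) (avail v) else ∅

/-- The items left at the values `v` after the first `k` buyers in the order had their turn.
It depends only on the values of those buyers. -/
def remaining (T : SeqTwoPartTariff n m) (D : Fin n → Fin m → Measure ℝ) :
    ℕ → ValueProfile n m → Finset (Fin m)
  | 0 => fun _ => Finset.univ
  | k + 1 => fun v =>
    if h : k < n then
      remaining T D k v \ T.purchase D (T.order ⟨k, h⟩) (remaining T D k) v
    else remaining T D k v

/-- The items available to buyer `i` at his turn. -/
def available (T : SeqTwoPartTariff n m) (D : Fin n → Fin m → Measure ℝ) (i : Fin n) :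
    ValueProfile n m → Finset (Fin m) :=
  T.remaining D (T.order.symm i : Fin n)

open Classical in
/-- The mechanism run by a sequential two-part tariff: participating buyers pay their entry fee
and the prices of the items they buy. -/
def mechanism (T : SeqTwoPartTariff n m) (D : Fin n → Fin m → Measure ℝ) : Mechanism n m where
  alloc v := PMF.pure fun i => T.purchase D i (T.available D i) v
  pay v i :=
    if T.Participates D i (T.available D i) (v i) then
      T.fee i + ∑ j ∈ T.purchase D i (T.available D i) v, T.price i j
    else 0

end SeqTwoPartTariff

end Auction

end

/-!
Fix a truthful mechanism `M`. Only the interim allocation and payment of every buyer matter, and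
these form a truthful mechanism for that buyer alone; the buyers interact only through the
probabilities `q i j` that buyer `i` receives item `j`, which sum to at most `1` over `i`.

Put `s i j = (q i j + 1 / n) / 4`, so that `∑ i, s i j ≤ 1 / 2`, and let the base price `b i j` be a
quantile of `D i j`: values above `b i j` have probability at most `s i j`, values from `b i j` on
probability at least `s i j`. Let `R i j` be the supremum of `(r - b i j) * P(v i j ≥ r)` over
`r > b i j`; it is finite, as `optRevenue D` is, because a posted price for one item is truthful
(`posted_price_le_optRevenue`). The payment of buyer `i` splits into three parts
(`payment_decomposition`, `single_buyer_bound`).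

* The base prices of the items he receives: in expectation `∑ j, b i j * q i j`.
* The surplus above the base price from his favourite item, minus his whole utility. With the other
  values fixed, this is the payment, above the base price, in a truthful mechanism for one item. Such
  a mechanism is a mixture of posted prices (`lintegral_payment_le`), so this part is at most
  `∑ j, R i j`.
* The surplus above the base price from the items that are not his favourite. Surplus larger than
  `∑ j, R i j` contributes at most `∑ j, R i j` (`lintegral_tail_le`), since another item must have a
  surplus at least as large. The sum of the smaller surpluses has a variance of at most
  `2 * (∑ j, R i j) ^ 2`, so it is at least its mean minus `2 * ∑ j, R i j` with probability at least
  `1 / 2` (`core_concentration`). An entry fee just below half of that bound is accepted whenever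
  this happens, because the gain expected from entering is at least half of the total surplus.

On the side of the tariffs, the base prices and the `R i j` are earned by sequential posted prices,
by a prophet inequality (`SeqTwoPartTariff.exists_posted_prices`). For the entry fees, prices just
above `b i j` leave every item available with probability at least `1 / 2` at every turn, and
this does not depend on the buyer's own values; hence his expected gain is additive over the items
and at least half of his total surplus (`SeqTwoPartTariff.sum_fee_le_revenue`). The three tariffs
enter with the weights `8`, `8` and `4`, so the best of them earns a `1 / 20` share of the revenue of
`M` up to an arbitrarily small error (`exists_tariff_revenue_le`).
-/

noncomputable section

namespace Auction

open Set Filter Topology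

/-! ### Resampling one coordinate of a product measure -/

/-- Replacing one coordinate by an independent sample from the same law does not change the
product measure. -/
theorem measurePreserving_update {ι : Type*} [Fintype ι] [DecidableEq ι] {X : ι → Type*}
    [∀ i, MeasurableSpace (X i)] (μ : ∀ i, Measure (X i)) [∀ i, IsProbabilityMeasure (μ i)]
    (i : ι) :
    MeasurePreserving (fun q : X i × (∀ j, X j) => Function.update q.2 i q.1)
      ((μ i).prod (Measure.pi μ)) (Measure.pi μ) := by
  have hmeas : Measurable (fun q : X i × (∀ j, X j) => Function.update q.2 i q.1) := by
    refine measurable_pi_lambda _ fun j => ?_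
    by_cases h : j = i
    · subst h
      simpa using measurable_fst
    · simp only [Function.update_of_ne h]
      exact (measurable_pi_apply j).comp measurable_snd
  refine ⟨hmeas, (Measure.pi_eq fun s hs => ?_).symm⟩
  rw [Measure.map_apply hmeas (MeasurableSet.univ_pi hs)]
  have hpre : (fun q : X i × (∀ j, X j) => Function.update q.2 i q.1) ⁻¹' (univ.pi s) =
      s i ×ˢ univ.pi (Function.update s i univ) := by
    ext q
    simp only [mem_preimage, Set.mem_pi, mem_univ, true_implies, mem_prod]
    constructor
    · intro h
      refine ⟨by simpa using h i, fun j => ?_⟩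
      by_cases hj : j = i
      · subst hj; simp
      · simpa [Function.update_of_ne hj] using h j
    · rintro ⟨h1, h2⟩ j
      by_cases hj : j = i
      · subst hj; simpa using h1
      · simpa [Function.update_of_ne hj] using h2 j
  rw [hpre, Measure.prod_prod, Measure.pi_pi, ← Finset.mul_prod_erase _ _ (Finset.mem_univ i),
    ← Finset.mul_prod_erase _ (fun j => μ j (s j)) (Finset.mem_univ i)]
  simp only [Function.update_self, measure_univ, one_mul]
  congr 1
  refine Finset.prod_congr rfl fun j hj => ?_
  rw [Function.update_of_ne (Finset.ne_of_mem_erase hj)]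

/-- Tonelli's theorem for one resampled coordinate. -/
theorem lintegral_update {ι : Type*} [Fintype ι] [DecidableEq ι] {X : ι → Type*}
    [∀ i, MeasurableSpace (X i)] (μ : ∀ i, Measure (X i)) [∀ i, IsProbabilityMeasure (μ i)]
    (i : ι) {f : (∀ j, X j) → ENNReal} (hf : Measurable f) :
    ∫⁻ v, f v ∂Measure.pi μ =
      ∫⁻ v, ∫⁻ z, f (Function.update v i z) ∂μ i ∂Measure.pi μ := by
  have h := measurePreserving_update μ i
  rw [← h.lintegral_comp hf]
  exact lintegral_prod_symm' _ (hf.comp h.measurable)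

theorem integral_update {ι : Type*} [Fintype ι] [DecidableEq ι] {X : ι → Type*}
    [∀ i, MeasurableSpace (X i)] (μ : ∀ i, Measure (X i)) [∀ i, IsProbabilityMeasure (μ i)]
    (i : ι) {f : (∀ j, X j) → ℝ} (hm : Measurable f) (hf : Integrable f (Measure.pi μ)) :
    Integrable (fun z => ∫ v, f (Function.update v i z) ∂Measure.pi μ) (μ i) ∧
    ∫ v, f v ∂Measure.pi μ =
      ∫ z, ∫ v, f (Function.update v i z) ∂Measure.pi μ ∂μ i := by
  have h := measurePreserving_update μ i
  have hint := (h.integrable_comp hm.aestronglyMeasurable).2 hf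
  refine ⟨hint.integral_prod_left, ?_⟩
  calc ∫ v, f v ∂Measure.pi μ
      = ∫ q, f (Function.update q.2 i q.1) ∂(μ i).prod (Measure.pi μ) := by
        conv_lhs => rw [← h.map_eq]
        exact integral_map h.aemeasurable hm.aestronglyMeasurable
    _ = _ := integral_prod _ hint

theorem ae_ae_update {ι : Type*} [Fintype ι] [DecidableEq ι] {X : ι → Type*}
    [∀ i, MeasurableSpace (X i)] (μ : ∀ i, Measure (X i)) [∀ i, IsProbabilityMeasure (μ i)]
    (i : ι) {P : (∀ j, X j) → Prop} (hP : ∀ᵐ v ∂Measure.pi μ, P v) :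
    ∀ᵐ v ∂Measure.pi μ, ∀ᵐ z ∂μ i, P (Function.update v i z) := by
  have h := (measurePreserving_update μ i).comp Measure.measurePreserving_swap
  exact Measure.ae_ae_of_ae_prod (h.quasiMeasurePreserving.ae hP)

/-- An event that does not depend on coordinate `i` is independent of that coordinate. -/
theorem measureReal_inter_eval {ι : Type*} [Fintype ι] [DecidableEq ι] {X : ι → Type*}
    [∀ i, MeasurableSpace (X i)] (μ : ∀ i, Measure (X i)) [∀ i, IsProbabilityMeasure (μ i)]
    (i : ι) {A : Set (∀ j, X j)} (hA : MeasurableSet A)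
    (hAi : ∀ v z, Function.update v i z ∈ A ↔ v ∈ A) {B : Set (X i)} (hB : MeasurableSet B) :
    (Measure.pi μ).real (A ∩ {v | v i ∈ B}) = (Measure.pi μ).real A * (μ i).real B := by
  have hBm : MeasurableSet {v : ∀ j, X j | v i ∈ B} := measurable_pi_apply i hB
  simp only [Measure.real]
  rw [← ENNReal.toReal_mul]
  congr 1
  rw [← lintegral_indicator_one (hA.inter hBm),
    lintegral_update μ i (measurable_one.indicator (hA.inter hBm)), mul_comm,
    ← lintegral_indicator_const hA]
  refine lintegral_congr fun v => ?_
  by_cases hv : v ∈ A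
  · rw [indicator_of_mem hv, ← lintegral_indicator_one hB]
    refine lintegral_congr fun z => ?_
    by_cases hz : z ∈ B <;> simp [indicator, hAi, hv, hz]
  · rw [indicator_of_notMem hv]
    simp [indicator, hAi, hv]

/-! ### Quantiles -/

/-- Both inequalities can be strict only at an atom; `0 < s` makes the quantile finite. -/
theorem exists_quantile (μ : Measure ℝ) [IsProbabilityMeasure μ] (hμ : ∀ᵐ x ∂μ, 0 ≤ x)
    {s : ℝ} (hs : 0 < s) (hs1 : s ≤ 1) :
    ∃ b : ℝ, 0 ≤ b ∧ μ.real (Ioi b) ≤ s ∧ s ≤ μ.real (Ici b) := by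
  set A : Set ℝ := {x | s ≤ μ.real (Ici x)} with hA
  have h0 : (0 : ℝ) ∈ A := by
    have : μ.real (Ici 0) = 1 := by
      rw [Measure.real, (prob_compl_eq_zero_iff measurableSet_Ici).1 _]
      · simp
      · exact hμ
    simpa [hA, this] using hs1
  have hbdd : BddAbove A := by
    have hlim : Tendsto (fun n : ℕ => μ (Ici (n : ℝ))) atTop (𝓝 (μ (⋂ n : ℕ, Ici (n : ℝ)))) := by
      refine tendsto_measure_iInter_atTop (fun n => measurableSet_Ici.nullMeasurableSet) ?_
        ⟨0, measure_ne_top _ _⟩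
      intro a c hac
      exact Ici_subset_Ici.2 (Nat.cast_le.2 hac)
    have hempty : (⋂ n : ℕ, Ici (n : ℝ)) = ∅ := by
      ext x
      simp only [mem_iInter, mem_Ici, mem_empty_iff_false, iff_false, not_forall, not_le]
      exact exists_nat_gt x
    rw [hempty, measure_empty] at hlim
    have hev := hlim.eventually (gt_mem_nhds (ENNReal.ofReal_pos.2 hs))
    obtain ⟨n, hn⟩ := hev.exists
    refine ⟨n, fun x hx => ?_⟩
    by_contra! hlt
    have h1 : μ (Ici x) ≤ μ (Ici (n : ℝ)) := measure_mono (Ici_subset_Ici.2 hlt.le)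
    have h2 : μ.real (Ici x) < s := by
      rw [Measure.real, ← ENNReal.lt_ofReal_iff_toReal_lt (measure_ne_top _ _)]
      exact h1.trans_lt hn
    exact absurd hx (not_le.2 h2)
  refine ⟨sSup A, le_csSup hbdd h0, ?_, ?_⟩
  · have hun : (⋃ n : ℕ, Ici (sSup A + 1 / ((n : ℝ) + 1))) = Ioi (sSup A) := by
      ext x
      simp only [mem_iUnion, mem_Ici, mem_Ioi]
      constructor
      · rintro ⟨n, hn⟩
        have : 0 < 1 / ((n : ℝ) + 1) := by positivity
        linarith
      · intro hx
        obtain ⟨n, hn⟩ := exists_nat_one_div_lt (sub_pos.2 hx)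
        exact ⟨n, by linarith⟩
    have hlim := tendsto_measure_iUnion_atTop (μ := μ)
      (s := fun n : ℕ => Ici (sSup A + 1 / ((n : ℝ) + 1))) (by
        intro a c hac
        refine Ici_subset_Ici.2 ?_
        have := one_div_le_one_div_of_le (by positivity : 0 < (a : ℝ) + 1)
          (by exact_mod_cast Nat.succ_le_succ hac : (a : ℝ) + 1 ≤ (c : ℝ) + 1)
        linarith)
    rw [hun] at hlim
    have hle : μ (Ioi (sSup A)) ≤ ENNReal.ofReal s := by
      refine le_of_tendsto' hlim fun n => ?_
      have hn : ¬ (sSup A + 1 / ((n : ℝ) + 1) ∈ A) := fun hmem => by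
        have := le_csSup hbdd hmem
        have : 0 < 1 / ((n : ℝ) + 1) := by positivity
        linarith
      have hn' : μ.real (Ici (sSup A + 1 / ((n : ℝ) + 1))) < s := not_le.1 hn
      exact (ENNReal.le_ofReal_iff_toReal_le (measure_ne_top _ _) hs.le).2 hn'.le
    exact ENNReal.toReal_le_of_le_ofReal hs.le hle
  · have hin : (⋂ n : ℕ, Ici (sSup A - 1 / ((n : ℝ) + 1))) = Ici (sSup A) := by
      ext x
      simp only [mem_iInter, mem_Ici]
      constructor
      · intro h
        by_contra! hx
        obtain ⟨n, hn⟩ := exists_nat_one_div_lt (sub_pos.2 hx)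
        have := h n
        linarith
      · intro hx n
        have : 0 < 1 / ((n : ℝ) + 1) := by positivity
        linarith
    have hlim := tendsto_measure_iInter_atTop (μ := μ)
      (s := fun n : ℕ => Ici (sSup A - 1 / ((n : ℝ) + 1)))
      (fun n => measurableSet_Ici.nullMeasurableSet) (by
        intro a c hac
        refine Ici_subset_Ici.2 ?_
        have := one_div_le_one_div_of_le (by positivity : 0 < (a : ℝ) + 1)
          (by exact_mod_cast Nat.succ_le_succ hac : (a : ℝ) + 1 ≤ (c : ℝ) + 1)
        linarith) ⟨0, measure_ne_top _ _⟩
    rw [hin] at hlim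
    have hge : ENNReal.ofReal s ≤ μ (Ici (sSup A)) := by
      refine ge_of_tendsto' hlim fun n => ?_
      have hpos : 0 < 1 / ((n : ℝ) + 1) := by positivity
      obtain ⟨y, hyA, hy⟩ := exists_lt_of_lt_csSup ⟨0, h0⟩ (sub_lt_self (sSup A) hpos)
      calc ENNReal.ofReal s ≤ μ (Ici y) := ENNReal.ofReal_le_of_le_toReal hyA
        _ ≤ _ := measure_mono (Ici_subset_Ici.2 hy.le)
    exact (ENNReal.ofReal_le_iff_le_toReal (measure_ne_top _ _)).1 hge

/-! ### Truthful mechanisms for one buyer and one item -/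

/-- The payment formula for one item, restricted to reports above the base price `b`. If the buyer
with value `v` has the indirect utility `g v` and the allocation `x`, a subgradient of `g` at `v`,
then `g v` is at least the integral of the right derivative `D` of `g` over `[b, v]`, so the payment
above `b` is at most the integral of `D v - D z` over the reports `z` between `b` and `v`. -/
theorem subgradient_payment_le {g : ℝ → ℝ} (hconv : ConvexOn ℝ univ g) (hg0 : ∀ z, 0 ≤ g z)
    {x v b : ℝ} (hx : ∀ z, g v + x * (z - v) ≤ g z) :
    ENNReal.ofReal (x * max (v - b) 0 - g v) ≤
      ∫⁻ z in Ioi b, ENNReal.ofReal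
        (derivWithin g (Ioi v) v - derivWithin g (Ioi z) z) := by
  set D : ℝ → ℝ := fun z => derivWithin g (Ioi z) z with hD
  have hDmono : Monotone D := by
    have := hconv.monotoneOn_rightDeriv
    rw [interior_univ] at this
    exact monotoneOn_univ.1 this
  rcases le_or_gt v b with hvb | hvb
  · rw [max_eq_right (by linarith), mul_zero, zero_sub,
      ENNReal.ofReal_of_nonpos (neg_nonpos.2 (hg0 v))]
    exact zero_le
  have hxD : x ≤ D v := by
    simp only [hD]
    rw [hconv.rightDeriv_eq_sInf_slope_of_mem_interior (by simp)]
    refine le_csInf ⟨slope g v (v + 1), v + 1, by simp, rfl⟩ ?_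
    rintro _ ⟨y, ⟨-, hy⟩, rfl⟩
    rw [slope_def_field, le_div_iff₀ (sub_pos.2 hy)]
    linarith [hx y]
  have hcont : Continuous g := by
    have := hconv.continuousOn isOpen_univ
    exact continuousOn_univ.1 this
  have hDint : IntervalIntegrable D volume b v := hDmono.intervalIntegrable
  have hftc : ∫ z in b..v, D z = g v - g b :=
    intervalIntegral.integral_eq_sub_of_hasDeriv_right hcont.continuousOn
      (fun z _ => hconv.hasDerivWithinAt_rightDeriv_of_mem_interior (by simp)) hDint
  have hsub : ∫ z in b..v, (D v - D z) = D v * (v - b) - (g v - g b) := by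
    rw [intervalIntegral.integral_sub (by simp) hDint, hftc, intervalIntegral.integral_const]
    simp [mul_comm]
  have hle : x * max (v - b) 0 - g v ≤ ∫ z in b..v, (D v - D z) := by
    rw [hsub, max_eq_left (by linarith)]
    nlinarith [hg0 b, mul_le_mul_of_nonneg_right hxD (sub_nonneg.2 hvb.le)]
  refine (ENNReal.ofReal_le_ofReal hle).trans ?_
  rw [intervalIntegral.integral_of_le hvb.le, ofReal_integral_eq_lintegral_ofReal]
  · exact lintegral_mono_set Ioc_subset_Ioi_self
  · exact ((intervalIntegrable_iff_integrableOn_Ioc_of_le hvb.le).1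
      ((by simp : IntervalIntegrable (fun _ => D v) volume b v).sub hDint))
  · refine (ae_restrict_iff' measurableSet_Ioc).2 (Eventually.of_forall fun z hz => ?_)
    simpa using hDmono hz.2

/-- A truthful mechanism for one item (with indirect utility `g` and allocation `x`) earns,
above the base price `b`, no more than the best posted price does: by the layer-cake formula it
is a mixture of posted prices. -/
theorem lintegral_payment_le (μ : Measure ℝ) [IsProbabilityMeasure μ] {g x : ℝ → ℝ}
    (hconv : ConvexOn ℝ univ g) (hmono : Monotone g)
    (hlip : ∀ z w, z ≤ w → g w - g z ≤ w - z) (hg0 : ∀ z, 0 ≤ g z)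
    (hx : ∀ᵐ v ∂μ, ∀ z, g v + x v * (z - v) ≤ g z) {b R : ℝ}
    (hR : ∀ r, b < r → (r - b) * μ.real (Ici r) ≤ R) :
    ∫⁻ v, ENNReal.ofReal (x v * max (v - b) 0 - g v) ∂μ ≤ ENNReal.ofReal R := by
  set D : ℝ → ℝ := fun z => derivWithin g (Ioi z) z with hD
  have hDmono : Monotone D := by
    have := hconv.monotoneOn_rightDeriv
    rw [interior_univ] at this
    exact monotoneOn_univ.1 this
  have hslope : ∀ z, D z = sInf (slope g z '' {y | y ∈ univ ∧ z < y}) := fun z =>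
    hconv.rightDeriv_eq_sInf_slope_of_mem_interior (by simp)
  have hslope0 : ∀ z, ∀ q ∈ slope g z '' {y | y ∈ univ ∧ z < y}, 0 ≤ q := by
    rintro z _ ⟨y, ⟨-, hy⟩, rfl⟩
    rw [slope_def_field]
    exact div_nonneg (sub_nonneg.2 (hmono (le_of_lt hy))) (sub_nonneg.2 (le_of_lt hy))
  have hD0 : ∀ z, 0 ≤ D z := fun z => by
    rw [hslope]
    exact Real.sInf_nonneg (hslope0 z)
  have hD1 : ∀ z, D z ≤ 1 := fun z => by
    rw [hslope]
    refine (csInf_le ⟨0, hslope0 z⟩ ⟨z + 1, by simp, rfl⟩).trans ?_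
    rw [slope_def_field, div_le_one (by linarith)]
    linarith [hlip z (z + 1) (by linarith)]
  have hDm : Measurable D := hDmono.measurable
  -- `K v z s` indicates that the report `v` wins, and the report `z` loses, at the level `s`
  set K : ℝ → ℝ → ℝ → ENNReal := fun v z s => {q : ℝ | D z ≤ q ∧ q < D v}.indicator 1 s with hK
  have hlevel : ∀ v z, ENNReal.ofReal (D v - D z) = ∫⁻ s in Ico 0 1, K v z s := fun v z => by
    have hset : {q : ℝ | D z ≤ q ∧ q < D v} = Ico (D z) (D v) := rfl
    simp only [hK, hset]
    rw [lintegral_indicator_one measurableSet_Ico,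
      Measure.restrict_apply measurableSet_Ico,
      inter_eq_left.2 (Ico_subset_Ico (hD0 z) (hD1 v)), Real.volume_Ico]
  have hKm : Measurable fun q : ℝ × ℝ × ℝ => K q.1 q.2.1 q.2.2 := by
    have : (fun q : ℝ × ℝ × ℝ => K q.1 q.2.1 q.2.2) =
        {q : ℝ × ℝ × ℝ | D q.2.1 ≤ q.2.2 ∧ q.2.2 < D q.1}.indicator 1 := by
      ext q
      simp [hK, indicator]
    rw [this]
    refine measurable_one.indicator ?_
    exact (measurableSet_le (hDm.comp measurable_snd.fst) measurable_snd.snd).inter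
      (measurableSet_lt measurable_snd.snd (hDm.comp measurable_fst))
  calc ∫⁻ v, ENNReal.ofReal (x v * max (v - b) 0 - g v) ∂μ
      ≤ ∫⁻ v, (∫⁻ z in Ioi b, ∫⁻ s in Ico 0 1, K v z s) ∂μ := by
        refine lintegral_mono_ae (hx.mono fun v hv => ?_)
        refine (subgradient_payment_le hconv hg0 hv).trans_eq ?_
        exact lintegral_congr fun z => hlevel v z
    _ = ∫⁻ v, (∫⁻ s in Ico 0 1, ∫⁻ z in Ioi b, K v z s) ∂μ := by
        refine lintegral_congr fun v => ?_
        exact lintegral_lintegral_swap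
          (hKm.comp (measurable_const.prodMk (measurable_fst.prodMk measurable_snd))).aemeasurable
    _ = ∫⁻ s in Ico (0 : ℝ) 1, ∫⁻ v, (∫⁻ z in Ioi b, K v z s) ∂μ := by
        refine lintegral_lintegral_swap ?_
        refine (Measurable.lintegral_prod_right' (f := fun q : (ℝ × ℝ) × ℝ => K q.1.1 q.2 q.1.2)
          ?_).aemeasurable
        exact hKm.comp (measurable_fst.fst.prodMk (measurable_snd.prodMk measurable_fst.snd))
    _ ≤ ∫⁻ s in Ico (0 : ℝ) 1, ENNReal.ofReal R := by
        refine lintegral_mono fun s => ?_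
        set A : Set ℝ := {v | s < D v} with hA
        set B : Set ℝ := {z | D z ≤ s} ∩ Ioi b with hB
        have hAm : MeasurableSet A := measurableSet_lt measurable_const hDm
        have hBm : MeasurableSet {z | D z ≤ s} := measurableSet_le hDm measurable_const
        have hprod : ∫⁻ v, (∫⁻ z in Ioi b, K v z s) ∂μ = volume B * μ A := by
          have : ∀ v, (∫⁻ z in Ioi b, K v z s) = A.indicator (fun _ => volume B) v := fun v => by
            have h1 : ∀ z, K v z s =
                {z | D z ≤ s}.indicator (fun _ => A.indicator 1 v) z := fun z => by
              by_cases h : D z ≤ s <;> by_cases h' : s < D v <;> simp [hK, hA, h, h']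
            simp_rw [h1]
            rw [lintegral_indicator_const hBm, Measure.restrict_apply hBm]
            by_cases h' : v ∈ A <;> simp [h', hB]
          simp_rw [this]
          rw [lintegral_indicator_const hAm]
        rw [hprod]
        have hBA : ∀ z ∈ B, ∀ v ∈ A, z ≤ v := fun z hz v hv => by
          by_contra! h
          exact absurd (hDmono h.le) (not_le.2 (lt_of_le_of_lt hz.1 hv))
        rcases A.eq_empty_or_nonempty with hAe | ⟨v₀, hv₀⟩
        · simp [hAe]
        rcases B.eq_empty_or_nonempty with hBe | ⟨z₀, hz₀⟩
        · simp [hBe]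
        have hbdd : BddAbove B := ⟨v₀, fun z hz => hBA z hz v₀ hv₀⟩
        have hr : b < sSup B := lt_of_lt_of_le hz₀.2 (le_csSup hbdd hz₀)
        calc volume B * μ A ≤ volume (Ioc b (sSup B)) * μ (Ici (sSup B)) := by
              refine mul_le_mul' (measure_mono fun z hz => ⟨hz.2, le_csSup hbdd hz⟩)
                (measure_mono fun v hv => csSup_le ⟨z₀, hz₀⟩ fun z hz => hBA z hz v hv)
          _ = ENNReal.ofReal ((sSup B - b) * μ.real (Ici (sSup B))) := by
              rw [Real.volume_Ioc, ENNReal.ofReal_mul (by linarith), Measure.real,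
                ENNReal.ofReal_toReal (measure_ne_top _ _)]
          _ ≤ ENNReal.ofReal R := ENNReal.ofReal_le_ofReal (hR _ hr)
    _ = ENNReal.ofReal R := by simp

variable {n m : ℕ}

/-! ### The favourite-item part of the revenue from one buyer -/

/-- The indirect utility of a menu of affine functions with slopes in `[0, 1]`, together with the
option of not taking part, is convex, monotone, `1`-Lipschitz and non-negative. -/
theorem menu_utility {κ : Type*} [Nonempty κ] {c a : κ → ℝ} (ha0 : ∀ r, 0 ≤ a r)
    (ha1 : ∀ r, a r ≤ 1) {z₀ : ℝ} (hb : BddAbove (range fun r => c r + a r * z₀)) :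
    ConvexOn ℝ univ (fun z => max 0 (⨆ r, c r + a r * z)) ∧
    Monotone (fun z => max 0 (⨆ r, c r + a r * z)) ∧
    (∀ z w, z ≤ w →
      max 0 (⨆ r, c r + a r * w) - max 0 (⨆ r, c r + a r * z) ≤ w - z) ∧
    (∀ z r, c r + a r * z ≤ ⨆ r, c r + a r * z) := by
  have hbz : ∀ z, BddAbove (range fun r => c r + a r * z) := fun z => by
    obtain ⟨B, hB⟩ := hb
    refine ⟨B + |z - z₀|, ?_⟩
    rintro _ ⟨r, rfl⟩
    have h1 : c r + a r * z₀ ≤ B := hB ⟨r, rfl⟩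
    have h2 : a r * (z - z₀) ≤ |z - z₀| :=
      (mul_le_mul_of_nonneg_left (le_abs_self _) (ha0 r)).trans
        (mul_le_of_le_one_left (abs_nonneg _) (ha1 r))
    have h3 : a r * (z - z₀) = a r * z - a r * z₀ := by ring
    simp only
    linarith
  have hle : ∀ z r, c r + a r * z ≤ ⨆ r, c r + a r * z := fun z r => le_ciSup (hbz z) r
  refine ⟨?_, ?_, ?_, hle⟩
  · refine (convexOn_const 0 convex_univ).sup ⟨convex_univ, fun z _ w _ α γ hα hγ hs => ?_⟩
    refine ciSup_le fun r => ?_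
    have h1 := mul_le_mul_of_nonneg_left (hle z r) hα
    have h2 := mul_le_mul_of_nonneg_left (hle w r) hγ
    simp only [smul_eq_mul]
    calc c r + a r * (α * z + γ * w)
        = (α + γ) * c r + a r * (α * z + γ * w) := by rw [hs, one_mul]
      _ = α * (c r + a r * z) + γ * (c r + a r * w) := by ring
      _ ≤ _ := add_le_add h1 h2
  · intro z w hzw
    refine max_le_max le_rfl (ciSup_le fun r => le_trans ?_ (hle w r))
    linarith [mul_le_mul_of_nonneg_left hzw (ha0 r)]
  · intro z w hzw
    have h1 : (⨆ r, c r + a r * w) ≤ (⨆ r, c r + a r * z) + (w - z) := by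
      refine ciSup_le fun r => ?_
      have h2 := mul_le_of_le_one_left (sub_nonneg.2 hzw) (ha1 r)
      have h3 : a r * (w - z) = a r * w - a r * z := by ring
      linarith [hle z r]
    rcases max_cases 0 (⨆ r, c r + a r * w) with h | h <;>
    linarith [le_max_left 0 (⨆ r, c r + a r * z), le_max_right 0 (⨆ r, c r + a r * z)]

/-- The part of the revenue that is due to item `j` alone, with the whole utility of the buyer
deducted, is at most the revenue of a posted price for item `j` above the base price `b`. The
values for the other items are fixed; the mechanism is then a truthful one for item `j`. -/
theorem lintegral_item_le (μ : Fin m → Measure ℝ) [∀ j, IsProbabilityMeasure (μ j)]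
    {S : Set (Fin m → ℝ)} (hS : ∀ᵐ t ∂Measure.pi μ, t ∈ S)
    {x : (Fin m → ℝ) → Fin m → ℝ} {p : (Fin m → ℝ) → ℝ}
    (hxm : ∀ j, Measurable fun t => x t j) (hpm : Measurable p)
    (hx0 : ∀ t j, 0 ≤ x t j) (hx1 : ∀ t j, x t j ≤ 1)
    (hIC : ∀ t ∈ S, ∀ r ∈ S, ∑ k, x r k * t k - p r ≤ ∑ k, x t k * t k - p t)
    (hIR : ∀ t ∈ S, 0 ≤ ∑ k, x t k * t k - p t) (j : Fin m) {b R : ℝ}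
    (hR : ∀ r, b < r → (r - b) * (μ j).real (Ici r) ≤ R) :
    ∫⁻ t, ENNReal.ofReal (x t j * max (t j - b) 0 - (∑ k, x t k * t k - p t)) ∂Measure.pi μ
      ≤ ENNReal.ofReal R := by
  rw [lintegral_update μ j (by fun_prop)]
  have hae := ae_ae_update μ j hS
  refine (lintegral_mono_ae (g := fun _ => ENNReal.ofReal R) (hae.mono fun t ht => ?_)).trans_eq
    (by simp)
  obtain ⟨z₀, hz₀⟩ := ht.exists
  have : Nonempty S := ⟨⟨_, hz₀⟩⟩
  set c : S → ℝ := fun r => ∑ k, x r k * Function.update t j 0 k - p r with hc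
  have hsplit : ∀ (r : S) z, ∑ k, x r k * Function.update t j z k - p r = c r + x r j * z := by
    intro r z
    have : ∑ k, x r k * Function.update t j z k
        = ∑ k, x r k * Function.update t j 0 k + x r j * z := by
      rw [← Finset.add_sum_erase _ _ (Finset.mem_univ j),
        ← Finset.add_sum_erase (a := j) _ (fun k => x r k * Function.update t j 0 k)
          (Finset.mem_univ j)]
      have : ∑ k ∈ Finset.univ.erase j, x r k * Function.update t j z k =
          ∑ k ∈ Finset.univ.erase j, x r k * Function.update t j 0 k :=
        Finset.sum_congr rfl fun k hk => by
          rw [Function.update_of_ne (Finset.ne_of_mem_erase hk),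
            Function.update_of_ne (Finset.ne_of_mem_erase hk)]
      rw [this]
      simp only [Function.update_self]
      ring
    rw [this, hc]
    ring
  have hb : BddAbove (range fun r : S => c r + x r j * z₀) := by
    refine ⟨∑ k, x (Function.update t j z₀) k * Function.update t j z₀ k
      - p (Function.update t j z₀), ?_⟩
    rintro _ ⟨r, rfl⟩
    simp only
    rw [← hsplit]
    exact hIC _ hz₀ r r.2
  obtain ⟨hconv, hmono, hlip, hle⟩ := menu_utility (fun r : S => hx0 r j) (fun r => hx1 r j) hb
  set g : ℝ → ℝ := fun z => max 0 (⨆ r : S, c r + x r j * z) with hg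
  have hgv : ∀ v, Function.update t j v ∈ S →
      g v = ∑ k, x (Function.update t j v) k * Function.update t j v k
        - p (Function.update t j v) := by
    intro v hv
    refine le_antisymm (max_le (hIR _ hv) (ciSup_le fun r => ?_)) ?_
    · rw [← hsplit]
      exact hIC _ hv r r.2
    · refine le_trans ?_ (le_max_right _ _)
      rw [hsplit ⟨_, hv⟩ v]
      exact hle v ⟨_, hv⟩
  have key := lintegral_payment_le (μ j) (x := fun v => x (Function.update t j v) j) hconv hmono
    hlip (fun z => le_max_left _ _) (b := b) (R := R) (by
      refine ht.mono fun v hv z => ?_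
      rw [hgv v hv, hsplit ⟨_, hv⟩ v]
      refine le_trans (le_of_eq ?_) ((hle z ⟨_, hv⟩).trans (le_max_right _ _))
      ring) hR
  refine le_trans (le_of_eq (lintegral_congr_ae (ht.mono fun v hv => ?_))) key
  rw [hgv v hv]
  simp

/-! ### The other items: tail and core -/

/-- Surplus above the base price `b` of a value at most `c` above it; zero for larger values. -/
def core (b c z : ℝ) : ℝ := if max (z - b) 0 ≤ c then max (z - b) 0 else 0

theorem core_nonneg (b c z : ℝ) : 0 ≤ core b c z := by
  unfold core
  split_ifs <;> simp

theorem core_le (b z : ℝ) {c : ℝ} (hc : 0 ≤ c) : core b c z ≤ c := by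
  unfold core
  split_ifs with h <;> assumption

theorem core_le_surplus (b c z : ℝ) : core b c z ≤ max (z - b) 0 := by
  unfold core
  split_ifs <;> simp

@[fun_prop]
theorem measurable_core (b c : ℝ) : Measurable (core b c) := by
  unfold core
  exact Measurable.ite (measurableSet_le (by fun_prop) (by fun_prop)) (by fun_prop) (by fun_prop)

theorem memLp_core (μ : Measure ℝ) [IsProbabilityMeasure μ] (b : ℝ) {c : ℝ} (hc : 0 ≤ c)
    (q : ENNReal) : MemLp (core b c) q μ :=
  MemLp.of_bound (by fun_prop) c (Eventually.of_forall fun z => by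
    rw [Real.norm_of_nonneg (core_nonneg _ _ _)]
    exact core_le _ _ hc)

/-- If no posted price above `b` earns more than `R` above `b`, then the truncated surplus has a
second moment of at most `2 * c * R`. -/
theorem integral_core_sq_le (μ : Measure ℝ) [IsProbabilityMeasure μ] {b c R : ℝ} (hc : 0 ≤ c)
    (hR0 : 0 ≤ R) (hR : ∀ r, b < r → (r - b) * μ.real (Ici r) ≤ R) :
    ∫ z, core b c z ^ 2 ∂μ ≤ 2 * c * R := by
  have h0 : 0 ≤ 2 * c * R := by positivity
  rw [integral_eq_lintegral_of_nonneg_ae (Eventually.of_forall fun z => sq_nonneg _)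
    (by fun_prop)]
  refine ENNReal.toReal_le_of_le_ofReal h0 ?_
  have hlc := lintegral_comp_eq_lintegral_meas_le_mul μ (f := core b c) (g := fun y => 2 * y)
    (Eventually.of_forall fun z => core_nonneg b c z) (by fun_prop)
    (fun t _ => (by fun_prop : Continuous fun y : ℝ => 2 * y).intervalIntegrable _ _)
    ((ae_restrict_iff' measurableSet_Ioi).2 (Eventually.of_forall fun y hy =>
      mul_nonneg (by norm_num) (le_of_lt hy)))
  have hsq : ∀ z, ∫ y in (0 : ℝ)..core b c z, 2 * y = core b c z ^ 2 := fun z => by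
    rw [intervalIntegral.integral_const_mul, integral_id]
    ring
  simp_rw [hsq] at hlc
  rw [hlc]
  calc ∫⁻ y in Ioi 0, μ {a | y ≤ core b c a} * ENNReal.ofReal (2 * y)
      ≤ ∫⁻ y in Ioi 0, (Ioc 0 c).indicator (fun _ => ENNReal.ofReal (2 * R)) y := by
        refine setLIntegral_mono' measurableSet_Ioi fun y hy => ?_
        have hy0 : (0 : ℝ) < y := hy
        by_cases hyc : y ≤ c
        · rw [indicator_of_mem (show y ∈ Ioc 0 c from ⟨hy, hyc⟩)]
          have hsub : {a | y ≤ core b c a} ⊆ Ici (b + y) := fun a ha => by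
            have h1 : y ≤ max (a - b) 0 := le_trans ha (core_le_surplus b c a)
            rcases le_max_iff.1 h1 with h | h
            · exact mem_Ici.2 (by linarith)
            · linarith
          calc μ {a | y ≤ core b c a} * ENNReal.ofReal (2 * y)
              ≤ μ (Ici (b + y)) * ENNReal.ofReal (2 * y) := by gcongr
            _ = ENNReal.ofReal (μ.real (Ici (b + y)) * (2 * y)) := by
                rw [ENNReal.ofReal_mul measureReal_nonneg, Measure.real,
                  ENNReal.ofReal_toReal (measure_ne_top _ _)]
            _ ≤ ENNReal.ofReal (2 * R) := by
                refine ENNReal.ofReal_le_ofReal ?_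
                have := hR (b + y) (by linarith)
                rw [add_sub_cancel_left] at this
                linarith
        · have : {a | y ≤ core b c a} = ∅ := by
            ext a
            simp only [mem_ofPred_eq, mem_empty_iff_false, iff_false, not_le]
            exact lt_of_le_of_lt (core_le b a hc) (not_le.1 hyc)
          simp [this]
    _ ≤ ∫⁻ y, (Ioc 0 c).indicator (fun _ => ENNReal.ofReal (2 * R)) y :=
        setLIntegral_le_lintegral _ _
    _ = ENNReal.ofReal (2 * c * R) := by
        rw [lintegral_indicator_const measurableSet_Ioc, Real.volume_Ioc, sub_zero,
          ← ENNReal.ofReal_mul (by positivity)]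
        congr 1
        ring

/-- The truncated surplus exceeds its mean minus `2 * ∑ R j` with probability at least `1 / 2`,
by Chebyshev's inequality. -/
theorem core_concentration (μ : Fin m → Measure ℝ) [∀ j, IsProbabilityMeasure (μ j)]
    {b R : Fin m → ℝ} (hR0 : ∀ j, 0 ≤ R j)
    (hR : ∀ j r, b j < r → (r - b j) * (μ j).real (Ici r) ≤ R j) :
    1 / 2 ≤ (Measure.pi μ).real {t | ∑ j, ∫ z, core (b j) (∑ k, R k) z ∂μ j - 2 * ∑ k, R k
      ≤ ∑ j, core (b j) (∑ k, R k) (t j)} := by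
  set c := ∑ k, R k with hc
  have hc0 : 0 ≤ c := Finset.sum_nonneg fun k _ => hR0 k
  set X : (Fin m → ℝ) → ℝ := fun t => ∑ j, core (b j) c (t j) with hX
  -- Chebyshev's inequality needs a positive deviation; for `c = 0` the truncated surplus vanishes.
  rcases hc0.eq_or_lt with hc1 | hc1
  · have hz : ∀ j z, core (b j) c z = 0 := fun j z =>
      le_antisymm ((core_le _ _ hc0).trans_eq hc1.symm) (core_nonneg _ _ _)
    have : {t | ∑ j, ∫ z, core (b j) c z ∂μ j - 2 * c ≤ ∑ j, core (b j) c (t j)} =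
        (univ : Set (Fin m → ℝ)) := by
      ext t
      simp only [hz]
      simp [← hc1]
    rw [this]
    simp
    norm_num
  have hmem : ∀ j, MemLp (core (b j) c) 2 (μ j) := fun j => memLp_core _ _ hc0 _
  have hXm : MemLp X 2 (Measure.pi μ) :=
    memLp_finsetSum _ fun j _ => (hmem j).comp_measurePreserving (measurePreserving_eval μ j)
  have hmean : ∫ t, X t ∂Measure.pi μ = ∑ j, ∫ z, core (b j) c z ∂μ j := by
    simp only [hX]
    rw [integral_finsetSum _ fun j _ => show Integrable (fun t : Fin m → ℝ => core (b j) c (t j)) _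
      from ((hmem j).comp_measurePreserving (measurePreserving_eval μ j)).integrable (by norm_num)]
    exact Finset.sum_congr rfl fun j _ => integral_comp_eval (by fun_prop)
  have hvar : ProbabilityTheory.variance X (Measure.pi μ) ≤ 2 * c ^ 2 := by
    have h1 : X = ∑ j, fun t : Fin m → ℝ => core (b j) c (t j) := by
      ext t
      simp [hX]
    rw [h1, ProbabilityTheory.variance_sum_pi hmem]
    calc ∑ j, ProbabilityTheory.variance (core (b j) c) (μ j)
        ≤ ∑ j, 2 * c * R j := Finset.sum_le_sum fun j _ =>
          (ProbabilityTheory.variance_le_expectation_sq (by fun_prop)).trans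
            (integral_core_sq_le _ hc0 (hR0 j) (hR j))
      _ = 2 * c ^ 2 := by
          rw [← Finset.mul_sum, ← hc]
          ring
  have hch := ProbabilityTheory.meas_ge_le_variance_div_sq hXm (c := 2 * c) (by linarith)
  rw [hmean] at hch
  have hbad : (Measure.pi μ).real {t | 2 * c ≤ |X t - ∑ j, ∫ z, core (b j) c z ∂μ j|} ≤ 1 / 2 := by
    refine ENNReal.toReal_le_of_le_ofReal (by norm_num)
      (hch.trans (ENNReal.ofReal_le_ofReal ?_))
    rw [div_le_iff₀ (by positivity)]
    linarith
  have hXmeas : Measurable X := by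
    simp only [hX]
    fun_prop
  have hcompl := probReal_compl_eq_one_sub (μ := Measure.pi μ)
    (s := {t | 2 * c ≤ |X t - ∑ j, ∫ z, core (b j) c z ∂μ j|})
    (measurableSet_le measurable_const (by fun_prop))
  refine le_trans (b := (Measure.pi μ).real
    {t | 2 * c ≤ |X t - ∑ j, ∫ z, core (b j) c z ∂μ j|}ᶜ) (by linarith) ?_
  refine measureReal_mono fun t ht => ?_
  have ht' : |X t - ∑ j, ∫ z, core (b j) c z ∂μ j| < 2 * c := not_le.1 ht
  have := (abs_lt.1 ht').1
  change _ ≤ X t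
  linarith

/-- Large surplus from an item that is not the favourite one: some other item has a surplus at
least as large, which happens with probability at most `R k / w`. -/
theorem lintegral_tail_le (μ : Fin m → Measure ℝ) [∀ j, IsProbabilityMeasure (μ j)]
    {b R : Fin m → ℝ} (hR0 : ∀ j, 0 ≤ R j)
    (hR : ∀ j r, b j < r → (r - b j) * (μ j).real (Ici r) ≤ R j) (j : Fin m) :
    ∫⁻ t, {t : Fin m → ℝ | ∑ k, R k < max (t j - b j) 0 ∧
        ∃ k, k ≠ j ∧ max (t j - b j) 0 ≤ max (t k - b k) 0}.indicator
        (fun t => ENNReal.ofReal (max (t j - b j) 0)) t ∂Measure.pi μ ≤ ENNReal.ofReal (R j) := by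
  set c := ∑ k, R k with hc
  have hc0 : 0 ≤ c := Finset.sum_nonneg fun k _ => hR0 k
  have hw : ∀ k, Measurable fun t : Fin m → ℝ => max (t k - b k) 0 := fun k => by fun_prop
  set A : Set (Fin m → ℝ) := {t | c < max (t j - b j) 0} with hA
  have hAm : MeasurableSet A := measurableSet_lt measurable_const (hw j)
  set F : Fin m → (Fin m → ℝ) → ENNReal := fun k t =>
    {t : Fin m → ℝ | c < max (t j - b j) 0 ∧ max (t j - b j) 0 ≤ max (t k - b k) 0}.indicator
      (fun t => ENNReal.ofReal (max (t j - b j) 0)) t with hF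
  have hFm : ∀ k, Measurable (F k) := fun k =>
    Measurable.indicator (by fun_prop) (hAm.inter (measurableSet_le (hw j) (hw k)))
  have hk : ∀ k, k ≠ j → ∫⁻ t, F k t ∂Measure.pi μ ≤
      ENNReal.ofReal (R k) * Measure.pi μ A := by
    intro k hkj
    rw [lintegral_update μ k (hFm k), ← lintegral_indicator_const hAm]
    refine lintegral_mono fun t => ?_
    by_cases ht : t ∈ A
    · rw [indicator_of_mem ht]
      set y := max (t j - b j) 0 with hy
      have hy0 : 0 < y := lt_of_le_of_lt hc0 ht
      have h1 : ∀ z, F k (Function.update t k z) ≤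
          (Ici (b k + y)).indicator (fun _ => ENNReal.ofReal y) z := fun z => by
        simp only [hF]
        refine indicator_apply_le' (fun hz => ?_) fun _ => zero_le
        simp only [mem_ofPred_eq, Function.update_of_ne hkj.symm, Function.update_self] at hz
        have hz2 : z ∈ Ici (b k + y) := by
          rcases le_max_iff.1 hz.2 with h | h
          · exact mem_Ici.2 (by linarith)
          · exact absurd (lt_of_lt_of_le hy0 h) (lt_irrefl _)
        rw [indicator_of_mem hz2, Function.update_of_ne hkj.symm]
      calc ∫⁻ z, F k (Function.update t k z) ∂μ k
          ≤ ∫⁻ z, (Ici (b k + y)).indicator (fun _ => ENNReal.ofReal y) z ∂μ k :=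
            lintegral_mono h1
        _ = ENNReal.ofReal ((b k + y - b k) * (μ k).real (Ici (b k + y))) := by
            rw [lintegral_indicator_const measurableSet_Ici, add_sub_cancel_left,
              ENNReal.ofReal_mul hy0.le, Measure.real, ENNReal.ofReal_toReal (measure_ne_top _ _)]
        _ ≤ ENNReal.ofReal (R k) := ENNReal.ofReal_le_ofReal (hR k _ (by linarith))
    · have : ∀ z, F k (Function.update t k z) = 0 := fun z => by
        simp only [hF]
        refine indicator_of_notMem ?_ _
        simp only [mem_ofPred_eq, Function.update_of_ne hkj.symm]
        exact fun h => ht h.1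
      simp [this]
  have hAle : c * (Measure.pi μ).real A ≤ R j := by
    rcases hc0.eq_or_lt with hc1 | hc1
    · rw [← hc1, zero_mul]
      exact hR0 j
    · have h1 : (Measure.pi μ).real A ≤ (μ j).real (Ici (b j + c)) := by
        rw [← (measurePreserving_eval μ j).measureReal_preimage
          measurableSet_Ici.nullMeasurableSet]
        refine measureReal_mono fun t ht => ?_
        rcases lt_max_iff.1 (show c < max (t j - b j) 0 from ht) with h | h
        · have h3 : b j + c ≤ t j := by linarith
          exact h3
        · linarith
      have h2 := hR j (b j + c) (by linarith)
      rw [add_sub_cancel_left] at h2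
      exact (mul_le_mul_of_nonneg_left h1 hc0).trans h2
  calc _ ≤ ∫⁻ t, ∑ k ∈ Finset.univ.erase j, F k t ∂Measure.pi μ := by
        refine lintegral_mono fun t => indicator_apply_le' ?_ fun _ => zero_le
        rintro ⟨h1, k, hkj, h2⟩
        refine le_trans (le_of_eq ?_) (Finset.single_le_sum (f := fun k => F k t)
          (fun _ _ => zero_le) (Finset.mem_erase.2 ⟨hkj, Finset.mem_univ k⟩))
        simp only [hF]
        rw [indicator_of_mem (show t ∈ {t : Fin m → ℝ | c < max (t j - b j) 0 ∧
          max (t j - b j) 0 ≤ max (t k - b k) 0} from ⟨h1, h2⟩)]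
    _ = ∑ k ∈ Finset.univ.erase j, ∫⁻ t, F k t ∂Measure.pi μ :=
        lintegral_finsetSum _ fun k _ => hFm k
    _ ≤ ∑ k ∈ Finset.univ.erase j, ENNReal.ofReal (R k) * Measure.pi μ A :=
        Finset.sum_le_sum fun k hk' => hk k (Finset.ne_of_mem_erase hk')
    _ ≤ ∑ k, ENNReal.ofReal (R k) * Measure.pi μ A :=
        Finset.sum_le_sum_of_subset (Finset.erase_subset _ _)
    _ = ENNReal.ofReal (c * (Measure.pi μ).real A) := by
        rw [← Finset.sum_mul, ← ENNReal.ofReal_sum_of_nonneg fun k _ => hR0 k,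
          ENNReal.ofReal_mul hc0, Measure.real, ENNReal.ofReal_toReal (measure_ne_top _ _)]
    _ ≤ ENNReal.ofReal (R j) := ENNReal.ofReal_le_ofReal hAle

/-- The payment of a buyer is at most: the base prices of what he gets; his surplus above the base
price from his favourite item minus his utility; and his surplus from all other items. -/
theorem payment_decomposition {x t b : Fin m → ℝ} {p : ℝ} (hx0 : ∀ j, 0 ≤ x j)
    (hx1 : ∀ j, x j ≤ 1) (hIR : 0 ≤ ∑ k, x k * t k - p) (c : ℝ) :
    p ≤ ∑ j, (x j * b j + max (x j * max (t j - b j) 0 - (∑ k, x k * t k - p)) 0 +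
      (({t : Fin m → ℝ | c < max (t j - b j) 0 ∧
        ∃ k, k ≠ j ∧ max (t j - b j) 0 ≤ max (t k - b k) 0}.indicator
        (fun t => max (t j - b j) 0) t) + core (b j) c (t j))) := by
  classical
  set u := ∑ k, x k * t k - p with hu
  set w : Fin m → ℝ := fun j => max (t j - b j) 0 with hw
  have hw0 : ∀ j, 0 ≤ w j := fun j => le_max_right _ _
  have h1 : ∑ j, x j * t j ≤ ∑ j, (x j * b j + x j * w j) := by
    refine Finset.sum_le_sum fun j _ => ?_
    have : x j * (t j - b j) ≤ x j * w j :=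
      mul_le_mul_of_nonneg_left (le_max_left _ _) (hx0 j)
    linarith
  set Tl : Fin m → ℝ := fun j => {t : Fin m → ℝ | c < max (t j - b j) 0 ∧
        ∃ k, k ≠ j ∧ max (t j - b j) 0 ≤ max (t k - b k) 0}.indicator
        (fun t => max (t j - b j) 0) t with hTl
  have hTl0 : ∀ j, 0 ≤ Tl j := fun j => indicator_apply_nonneg fun _ => hw0 j
  have h2 : ∑ j, x j * w j - u ≤
      ∑ j, (max (x j * w j - u) 0 + (Tl j + core (b j) c (t j))) := by
    rcases isEmpty_or_nonempty (Fin m) with he | hne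
    · simpa using hIR
    obtain ⟨j₀, hj₀⟩ := Finite.exists_max w
    rw [← Finset.add_sum_erase _ _ (Finset.mem_univ j₀),
      ← Finset.add_sum_erase _ _ (Finset.mem_univ j₀)]
    have h3 : ∑ j ∈ Finset.univ.erase j₀, x j * w j ≤
        ∑ j ∈ Finset.univ.erase j₀, (max (x j * w j - u) 0 + (Tl j + core (b j) c (t j))) := by
      refine Finset.sum_le_sum fun j hj => ?_
      have h4 : x j * w j ≤ w j := mul_le_of_le_one_left (hw0 j) (hx1 j)
      have h5 : w j ≤ Tl j + core (b j) c (t j) := by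
        by_cases hcw : w j ≤ c
        · have : core (b j) c (t j) = w j := if_pos hcw
          linarith [hTl0 j]
        · have : Tl j = w j := by
            simp only [hTl]
            rw [indicator_of_mem]
            exact ⟨not_le.1 hcw, j₀, (Finset.ne_of_mem_erase hj).symm, hj₀ j⟩
          linarith [core_nonneg (b j) c (t j)]
      linarith [le_max_right (x j * w j - u) 0]
    linarith [le_max_left (x j₀ * w j₀ - u) 0, hTl0 j₀, core_nonneg (b j₀) c (t j₀)]
  have h6 : p = ∑ j, x j * t j - u := by rw [hu]; ring
  have h7 : ∑ j, (x j * b j + max (x j * w j - u) 0 + (Tl j + core (b j) c (t j))) =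
      ∑ j, x j * b j + ∑ j, (max (x j * w j - u) 0 + (Tl j + core (b j) c (t j))) := by
    rw [← Finset.sum_add_distrib]
    exact Finset.sum_congr rfl fun j _ => by ring
  rw [Finset.sum_add_distrib] at h1
  change p ≤ ∑ j, (x j * b j + max (x j * w j - u) 0 + (Tl j + core (b j) c (t j)))
  rw [h7]
  linarith

/-- The revenue from one buyer, for arbitrary base prices `b`, in terms of the posted-price
revenues `R j` above the base prices and the truncated surplus. -/
theorem single_buyer_bound (μ : Fin m → Measure ℝ) [∀ j, IsProbabilityMeasure (μ j)]
    {S : Set (Fin m → ℝ)} (hS : ∀ᵐ t ∂Measure.pi μ, t ∈ S)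
    {x : (Fin m → ℝ) → Fin m → ℝ} {p : (Fin m → ℝ) → ℝ}
    (hxm : ∀ j, Measurable fun t => x t j) (hpm : Measurable p)
    (hx0 : ∀ t j, 0 ≤ x t j) (hx1 : ∀ t j, x t j ≤ 1)
    (hIC : ∀ t ∈ S, ∀ r ∈ S, ∑ k, x r k * t k - p r ≤ ∑ k, x t k * t k - p t)
    (hIR : ∀ t ∈ S, 0 ≤ ∑ k, x t k * t k - p t)
    {b R : Fin m → ℝ} (hb : ∀ j, 0 ≤ b j) (hR0 : ∀ j, 0 ≤ R j)
    (hR : ∀ j r, b j < r → (r - b j) * (μ j).real (Ici r) ≤ R j) :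
    ∫ t, p t ∂Measure.pi μ ≤ ∑ j, b j * ∫ t, x t j ∂Measure.pi μ + 2 * ∑ j, R j +
      ∑ j, ∫ z, core (b j) (∑ k, R k) z ∂μ j := by
  set c := ∑ k, R k with hc
  have hc0 : 0 ≤ c := Finset.sum_nonneg fun k _ => hR0 k
  have hxint : ∀ j, Integrable (fun t => x t j) (Measure.pi μ) := fun j =>
    Integrable.of_bound (hxm j).aestronglyMeasurable 1 (Eventually.of_forall fun t => by
      rw [Real.norm_of_nonneg (hx0 t j)]
      exact hx1 t j)
  have hx : ∀ j, 0 ≤ ∫ t, x t j ∂Measure.pi μ := fun j => integral_nonneg fun t => hx0 t j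
  have hcore : ∀ j, 0 ≤ ∫ z, core (b j) c z ∂μ j := fun j =>
    integral_nonneg fun z => core_nonneg _ _ _
  have hcint : ∀ j, Integrable (core (b j) c) (μ j) := fun j =>
    (memLp_core (μ j) (b j) hc0 1).integrable le_rfl
  set Tl : Fin m → (Fin m → ℝ) → ENNReal := fun j t => {t : Fin m → ℝ | c < max (t j - b j) 0 ∧
        ∃ k, k ≠ j ∧ max (t j - b j) 0 ≤ max (t k - b k) 0}.indicator
        (fun t => ENNReal.ofReal (max (t j - b j) 0)) t with hTl
  set U : Fin m → (Fin m → ℝ) → ENNReal := fun j t =>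
    ENNReal.ofReal (x t j * max (t j - b j) 0 - (∑ k, x t k * t k - p t)) with hU
  have hw : ∀ k, Measurable fun t : Fin m → ℝ => max (t k - b k) 0 := fun k => by fun_prop
  have hTlm : ∀ j, Measurable (Tl j) := fun j => by
    refine Measurable.indicator (by fun_prop) ?_
    refine (measurableSet_lt measurable_const (hw j)).inter ?_
    have : {t : Fin m → ℝ | ∃ k, k ≠ j ∧ max (t j - b j) 0 ≤ max (t k - b k) 0} =
        ⋃ k, ⋃ (_ : k ≠ j), {t | max (t j - b j) 0 ≤ max (t k - b k) 0} := by
      ext t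
      simp
    change MeasurableSet {t : Fin m → ℝ | ∃ k, k ≠ j ∧ max (t j - b j) 0 ≤ max (t k - b k) 0}
    rw [this]
    exact MeasurableSet.iUnion fun k => MeasurableSet.iUnion fun _ =>
      measurableSet_le (hw j) (hw k)
  have hUm : ∀ j, Measurable (U j) := fun j => by
    have := hxm j
    fun_prop
  have hpt : ∀ᵐ t ∂Measure.pi μ, ENNReal.ofReal (p t) ≤
      ∑ j, (ENNReal.ofReal (b j) * ENNReal.ofReal (x t j) + U j t +
        (Tl j t + ENNReal.ofReal (core (b j) c (t j)))) := by
    refine hS.mono fun t ht => ?_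
    refine (ENNReal.ofReal_le_ofReal
      (payment_decomposition (hx0 t) (hx1 t) (hIR t ht) (b := b) c)).trans ?_
    have hind0 : ∀ j, 0 ≤ {t : Fin m → ℝ | c < max (t j - b j) 0 ∧
        ∃ k, k ≠ j ∧ max (t j - b j) 0 ≤ max (t k - b k) 0}.indicator
        (fun t => max (t j - b j) 0) t := fun j =>
      indicator_apply_nonneg fun _ => le_max_right _ _
    have hxb : ∀ j, 0 ≤ x t j * b j := fun j => mul_nonneg (hx0 t j) (hb j)
    rw [ENNReal.ofReal_sum_of_nonneg fun j _ => add_nonneg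
      (add_nonneg (hxb j) (le_max_right _ _)) (add_nonneg (hind0 j) (core_nonneg _ _ _))]
    refine Finset.sum_le_sum fun j _ => le_of_eq ?_
    rw [ENNReal.ofReal_add (add_nonneg (hxb j) (le_max_right _ _))
      (add_nonneg (hind0 j) (core_nonneg _ _ _)), ENNReal.ofReal_add (hxb j) (le_max_right _ _),
      ENNReal.ofReal_add (hind0 j) (core_nonneg _ _ _), mul_comm (x t j),
      ENNReal.ofReal_mul (hb j)]
    congr 2
    · simp only [hU]
      rw [ENNReal.ofReal_max, ENNReal.ofReal_zero, max_eq_left zero_le]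
    · simp only [hTl, indicator]
      split_ifs <;> simp
  have hlint : ∫⁻ t, ENNReal.ofReal (p t) ∂Measure.pi μ ≤
      ∑ j, (ENNReal.ofReal (b j) * ENNReal.ofReal (∫ t, x t j ∂Measure.pi μ) +
        ENNReal.ofReal (R j) + (ENNReal.ofReal (R j) +
          ENNReal.ofReal (∫ z, core (b j) c z ∂μ j))) := by
    refine (lintegral_mono_ae hpt).trans ?_
    rw [lintegral_finsetSum _ fun j _ => by
      have := hxm j
      have := hTlm j
      have := hUm j
      fun_prop]
    refine Finset.sum_le_sum fun j _ => ?_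
    have := hxm j
    rw [lintegral_add_right _ (by have := hTlm j; fun_prop), lintegral_add_right _ (hUm j),
      lintegral_add_left (hTlm j), lintegral_const_mul _ (by fun_prop),
      ofReal_integral_eq_lintegral_ofReal (hxint j) (Eventually.of_forall fun t => hx0 t j),
      ofReal_integral_eq_lintegral_ofReal (hcint j)
        (Eventually.of_forall fun z => core_nonneg _ _ _),
      ← (measurePreserving_eval μ j).lintegral_comp
        (show Measurable fun z => ENNReal.ofReal (core (b j) c z) by fun_prop)]
    gcongr
    · exact lintegral_item_le μ hS hxm hpm hx0 hx1 hIC hIR j (hR j)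
    · exact lintegral_tail_le μ hR0 hR j
  -- Values, and hence the utility, may have infinite mean, so the estimates are made for the
  -- positive part of the payment.
  have htot : ∫ t, p t ∂Measure.pi μ ≤ (∫⁻ t, ENNReal.ofReal (p t) ∂Measure.pi μ).toReal := by
    by_cases hint : Integrable p (Measure.pi μ)
    · rw [integral_eq_lintegral_pos_part_sub_lintegral_neg_part hint]
      linarith [ENNReal.toReal_nonneg (a := ∫⁻ t, ENNReal.ofReal (-p t) ∂Measure.pi μ)]
    · rw [integral_undef hint]
      exact ENNReal.toReal_nonneg
  refine htot.trans (ENNReal.toReal_le_of_le_ofReal ?_ (hlint.trans_eq ?_))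
  · exact add_nonneg (add_nonneg (Finset.sum_nonneg fun j _ => mul_nonneg (hb j) (hx j))
      (mul_nonneg (by norm_num) hc0)) (Finset.sum_nonneg fun j _ => hcore j)
  · have : ∑ j, b j * ∫ t, x t j ∂Measure.pi μ + 2 * c + ∑ j, ∫ z, core (b j) c z ∂μ j =
        ∑ j, (b j * ∫ t, x t j ∂Measure.pi μ + R j + (R j + ∫ z, core (b j) c z ∂μ j)) := by
      simp only [Finset.sum_add_distrib, ← hc]
      ring
    rw [this, ENNReal.ofReal_sum_of_nonneg fun j _ => add_nonneg
      (add_nonneg (mul_nonneg (hb j) (hx j)) (hR0 j)) (add_nonneg (hR0 j) (hcore j))]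
    refine Finset.sum_congr rfl fun j _ => ?_
    rw [ENNReal.ofReal_add (add_nonneg (mul_nonneg (hb j) (hx j)) (hR0 j))
      (add_nonneg (hR0 j) (hcore j)), ENNReal.ofReal_add (mul_nonneg (hb j) (hx j)) (hR0 j),
      ENNReal.ofReal_add (hR0 j) (hcore j), ENNReal.ofReal_mul (hb j)]

/-! ### The course of a sequential two-part tariff -/

instance instIsProbabilityMeasureJointLaw (D : Fin n → Fin m → Measure ℝ)
    [∀ i j, IsProbabilityMeasure (D i j)] : IsProbabilityMeasure (jointLaw D) := by
  unfold jointLaw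
  infer_instance

theorem jointLaw_real_eval (D : Fin n → Fin m → Measure ℝ)
    [∀ i j, IsProbabilityMeasure (D i j)] (i : Fin n) {B : Set (Fin m → ℝ)}
    (hB : MeasurableSet B) :
    (jointLaw D).real {v | v i ∈ B} = (Measure.pi (D i)).real B :=
  (measurePreserving_eval (fun i => Measure.pi (D i)) i).measureReal_preimage
    hB.nullMeasurableSet

theorem pi_real_Ici (μ : Fin m → Measure ℝ) [∀ j, IsProbabilityMeasure (μ j)] (j : Fin m)
    (r : ℝ) : (Measure.pi μ).real {t | r ≤ t j} = (μ j).real (Ici r) :=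
  (measurePreserving_eval μ j).measureReal_preimage measurableSet_Ici.nullMeasurableSet

theorem jointLaw_real_Ici (D : Fin n → Fin m → Measure ℝ)
    [∀ i j, IsProbabilityMeasure (D i j)] (i : Fin n) (j : Fin m) (r : ℝ) :
    (jointLaw D).real {v | r ≤ v i j} = (D i j).real (Ici r) := by
  rw [← pi_real_Ici (D i) j r]
  exact jointLaw_real_eval D i (B := {t | r ≤ t j})
    (measurableSet_le measurable_const (measurable_pi_apply j))

namespace SeqTwoPartTariff

variable (T : SeqTwoPartTariff n m) (D : Fin n → Fin m → Measure ℝ)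

theorem mem_purchase {i : Fin n} {avail : ValueProfile n m → Finset (Fin m)}
    {v : ValueProfile n m} {j : Fin m} :
    j ∈ T.purchase D i avail v ↔
      T.Participates D i avail (v i) ∧ j ∈ avail v ∧ T.price i j ≤ v i j := by
  unfold purchase favorite
  split_ifs with h <;> simp [h]

theorem remaining_succ {k : ℕ} (h : k < n) (v : ValueProfile n m) :
    T.remaining D (k + 1) v =
      T.remaining D k v \ T.purchase D (T.order ⟨k, h⟩) (T.remaining D k) v := by
  simp [remaining, h]

theorem remaining_antitone (v : ValueProfile n m) : Antitone fun k => T.remaining D k v := by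
  refine antitone_nat_of_succ_le fun k => ?_
  by_cases h : k < n
  · rw [remaining_succ T D h]
    exact Finset.sdiff_subset
  · simp [remaining, h]

/-- The items left after `k` turns depend only on the values of the first `k` buyers. -/
theorem remaining_update {k : ℕ} {i : Fin n} (hk : k ≤ (T.order.symm i : ℕ))
    (v : ValueProfile n m) (t : Fin m → ℝ) :
    T.remaining D k (Function.update v i t) = T.remaining D k v := by
  induction k with
  | zero => rfl
  | succ k ih =>
    have hn : k < n := by omega
    have hne : T.order ⟨k, hn⟩ ≠ i := by
      rintro rfl
      simp at hk
    have ih' := ih (by omega)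
    rw [remaining_succ T D hn, remaining_succ T D hn, ih']
    congr 1
    ext j
    rw [mem_purchase, mem_purchase, ih', Function.update_of_ne hne]

theorem available_update (i : Fin n) (v : ValueProfile n m) (t : Fin m → ℝ) :
    T.available D i (Function.update v i t) = T.available D i v :=
  T.remaining_update D le_rfl v t

theorem exists_buyer_of_notMem_remaining {k : ℕ} {v : ValueProfile n m} {j : Fin m}
    (hj : j ∉ T.remaining D k v) :
    ∃ i, j ∈ T.available D i v ∧ T.price i j ≤ v i j := by
  induction k with
  | zero => simp [remaining] at hj
  | succ k ih =>
    by_cases h : k < n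
    · by_cases hk : j ∈ T.remaining D k v
      · rw [remaining_succ T D h, Finset.mem_sdiff, not_and_not_right] at hj
        have := (T.mem_purchase D).1 (hj hk)
        refine ⟨T.order ⟨k, h⟩, ?_, this.2.2⟩
        simpa [available] using hk
      · exact ih hk
    · refine ih ?_
      simpa [remaining, h] using hj

theorem supplyFeasible_mechanism : (T.mechanism D).SupplyFeasible := by
  have key : ∀ (v : ValueProfile n m) i₁ i₂, T.order.symm i₁ < T.order.symm i₂ →
      Disjoint (T.purchase D i₁ (T.available D i₁) v) (T.purchase D i₂ (T.available D i₂) v) := by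
    intro v i₁ i₂ h
    rw [Finset.disjoint_left]
    intro j h1 h2
    have h3 : j ∈ T.remaining D (T.order.symm i₂ : ℕ) v := ((T.mem_purchase D).1 h2).2.1
    have h4 : j ∈ T.remaining D ((T.order.symm i₁ : ℕ) + 1) v :=
      T.remaining_antitone D v (Nat.succ_le_of_lt h) h3
    rw [remaining_succ T D (T.order.symm i₁).isLt, Finset.mem_sdiff] at h4
    refine h4.2 ?_
    simpa [available] using h1
  intro v a ha i₁ i₂ hne
  simp only [mechanism, PMF.support_pure, mem_singleton_iff] at ha
  subst ha
  rcases lt_trichotomy (T.order.symm i₁) (T.order.symm i₂) with h | h | h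
  · exact key v _ _ h
  · exact absurd (T.order.symm.injective h) hne
  · exact (key v _ _ h).symm

theorem pay_eq_indicator (i : Fin n) (v : ValueProfile n m) :
    (T.mechanism D).pay v i =
      {v : ValueProfile n m | T.Participates D i (T.available D i) (v i)}.indicator
        (fun _ => T.fee i) v +
      ∑ j, {v | j ∈ T.purchase D i (T.available D i) v}.indicator (fun _ => T.price i j) v := by
  have h : ∑ j, {v | j ∈ T.purchase D i (T.available D i) v}.indicator (fun _ => T.price i j) v =
      ∑ j ∈ T.purchase D i (T.available D i) v, T.price i j := by
    simp [indicator]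
  rw [h]
  by_cases hp : T.Participates D i (T.available D i) (v i)
  · simp [mechanism, hp]
  · simp [mechanism, purchase, hp]

variable [∀ i j, IsProbabilityMeasure (D i j)]

/-- The expected gain is additive over the items, with the probabilities of availability as
weights. -/
theorem expectedGain_eq (i : Fin n) {avail : ValueProfile n m → Finset (Fin m)}
    (havail : ∀ j, MeasurableSet {w | j ∈ avail w}) (t : Fin m → ℝ) :
    T.expectedGain D i avail t =
      ∑ j, (jointLaw D).real {w | j ∈ avail w} * max (t j - T.price i j) 0 := by
  have h : ∀ w, ∑ j ∈ T.favorite i t (avail w), (t j - T.price i j) =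
      ∑ j, {w | j ∈ avail w}.indicator (fun _ => max (t j - T.price i j) 0) w := fun w => by
    have hmem : ∀ f : Fin m → ℝ, ∑ j ∈ avail w, f j = ∑ j, if j ∈ avail w then f j else 0 :=
      fun f => by simp [Finset.sum_ite_mem]
    rw [favorite, Finset.sum_filter, hmem]
    refine Finset.sum_congr rfl fun j _ => ?_
    by_cases hj : j ∈ avail w
    · by_cases hp : T.price i j ≤ t j
      · simp [hj, hp]
      · simp [hj, hp, (not_le.1 hp).le]
    · simp [hj]
  unfold expectedGain
  simp_rw [h]
  rw [integral_finsetSum _ fun j _ => (integrable_const _).indicator (havail j)]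
  refine Finset.sum_congr rfl fun j _ => ?_
  rw [integral_indicator_const _ (havail j), smul_eq_mul]

theorem measurableSet_participates (i : Fin n) {avail : ValueProfile n m → Finset (Fin m)}
    (havail : ∀ j, MeasurableSet {w | j ∈ avail w}) :
    MeasurableSet {t | T.Participates D i avail t} := by
  simp only [Participates, T.expectedGain_eq D i havail]
  exact measurableSet_le measurable_const (by fun_prop)

theorem measurableSet_mem_purchase (i : Fin n) {avail : ValueProfile n m → Finset (Fin m)}
    (havail : ∀ j, MeasurableSet {w | j ∈ avail w}) (j : Fin m) :
    MeasurableSet {v | j ∈ T.purchase D i avail v} := by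
  simp only [mem_purchase]
  refine ((measurable_pi_apply i) (T.measurableSet_participates D i havail)).inter
    ((havail j).inter (measurableSet_le measurable_const
      ((measurable_pi_apply j).comp (measurable_pi_apply i))))

theorem measurableSet_mem_remaining (k : ℕ) (j : Fin m) :
    MeasurableSet {v | j ∈ T.remaining D k v} := by
  induction k generalizing j with
  | zero => simp [remaining]
  | succ k ih =>
    by_cases h : k < n
    · simp only [remaining_succ T D h, Finset.mem_sdiff]
      exact (ih j).inter (T.measurableSet_mem_purchase D _ ih j).compl
    · simpa [remaining, h] using ih j

theorem measurableSet_mem_available (i : Fin n) (j : Fin m) :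
    MeasurableSet {v | j ∈ T.available D i v} :=
  T.measurableSet_mem_remaining D _ j

/-- The probability that buyer `i` finds item `j` and is ready to pay its price factorizes. -/
theorem measureReal_available_inter (i : Fin n) (j : Fin m) :
    (jointLaw D).real ({v | j ∈ T.available D i v} ∩ {v | T.price i j ≤ v i j}) =
      (jointLaw D).real {v | j ∈ T.available D i v} * (D i j).real (Ici (T.price i j)) := by
  rw [← pi_real_Ici (D i) j]
  exact measureReal_inter_eval (fun i => Measure.pi (D i)) i (T.measurableSet_mem_available D i j)
    (fun v z => by simp only [mem_ofPred_eq, available_update])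
    (B := {t | T.price i j ≤ t j}) (measurableSet_le measurable_const (measurable_pi_apply j))

/-- An item is sold at most as often as some buyer finds it and is ready to pay its price. -/
theorem one_sub_remaining_le (k : ℕ) (j : Fin m) :
    1 - (jointLaw D).real {v | j ∈ T.remaining D k v} ≤
      ∑ i, (jointLaw D).real {v | j ∈ T.available D i v} *
        (D i j).real (Ici (T.price i j)) := by
  rw [← probReal_compl_eq_one_sub (T.measurableSet_mem_remaining D k j)]
  simp_rw [← T.measureReal_available_inter D]
  refine le_trans (measureReal_mono fun v hv => ?_) (measureReal_iUnion_fintype_le _)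
  obtain ⟨i, h1, h2⟩ := T.exists_buyer_of_notMem_remaining D hv
  exact mem_iUnion.2 ⟨i, h1, h2⟩

theorem half_le_available {j : Fin m} (hj : ∑ i, (D i j).real (Ici (T.price i j)) ≤ 1 / 2)
    (i : Fin n) : 1 / 2 ≤ (jointLaw D).real {v | j ∈ T.available D i v} := by
  have h1 := T.one_sub_remaining_le D (T.order.symm i : ℕ) j
  have h2 : ∑ i, (jointLaw D).real {v | j ∈ T.available D i v} *
      (D i j).real (Ici (T.price i j)) ≤ ∑ i, (D i j).real (Ici (T.price i j)) :=
    Finset.sum_le_sum fun i _ => mul_le_of_le_one_left measureReal_nonneg measureReal_le_one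
  change 1 / 2 ≤ (jointLaw D).real {v | j ∈ T.remaining D (T.order.symm i : ℕ) v}
  linarith

/-! ### The revenue of a sequential two-part tariff -/

theorem revenue_eq : (T.mechanism D).revenue D =
    ∑ i, (T.fee i *
        (Measure.pi (D i)).real {t | T.Participates D i (T.available D i) t} +
      ∑ j, T.price i j * (jointLaw D).real {v | j ∈ T.purchase D i (T.available D i) v}) := by
  have hm1 : ∀ i, MeasurableSet
      {v : ValueProfile n m | T.Participates D i (T.available D i) (v i)} := fun i =>
    (T.measurableSet_participates D i (T.measurableSet_mem_available D i)).preimage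
      (measurable_pi_apply i)
  have hm2 : ∀ i j, MeasurableSet {v | j ∈ T.purchase D i (T.available D i) v} := fun i j =>
    T.measurableSet_mem_purchase D i (T.measurableSet_mem_available D i) j
  have hi1 : ∀ i, Integrable (fun v : ValueProfile n m =>
      {v : ValueProfile n m | T.Participates D i (T.available D i) (v i)}.indicator
        (fun _ => T.fee i) v) (jointLaw D) := fun i => (integrable_const _).indicator (hm1 i)
  have hi2 : ∀ i j, Integrable (fun v : ValueProfile n m =>
      {v | j ∈ T.purchase D i (T.available D i) v}.indicator (fun _ => T.price i j) v)
      (jointLaw D) := fun i j => (integrable_const _).indicator (hm2 i j)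
  have hi3 : ∀ i, Integrable (fun v : ValueProfile n m =>
      {v : ValueProfile n m | T.Participates D i (T.available D i) (v i)}.indicator
        (fun _ => T.fee i) v +
      ∑ j, {v | j ∈ T.purchase D i (T.available D i) v}.indicator (fun _ => T.price i j) v)
      (jointLaw D) := fun i => (hi1 i).add (integrable_finsetSum _ fun j _ => hi2 i j)
  unfold Mechanism.revenue
  simp_rw [T.pay_eq_indicator D]
  rw [integral_finsetSum _ fun i _ => hi3 i]
  refine Finset.sum_congr rfl fun i _ => ?_
  rw [integral_add (hi1 i) (integrable_finsetSum _ fun j _ => hi2 i j),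
    integral_finsetSum _ fun j _ => hi2 i j, integral_indicator_const _ (hm1 i), smul_eq_mul,
    mul_comm, ← jointLaw_real_eval D i
      (T.measurableSet_participates D i (T.measurableSet_mem_available D i))]
  congr 1
  refine Finset.sum_congr rfl fun j _ => ?_
  rw [integral_indicator_const _ (hm2 i j), smul_eq_mul, mul_comm]

theorem revenue_nonneg : 0 ≤ (T.mechanism D).revenue D := by
  rw [revenue_eq]
  exact Finset.sum_nonneg fun i _ => add_nonneg (mul_nonneg (T.fee_nonneg i) measureReal_nonneg)
    (Finset.sum_nonneg fun j _ => mul_nonneg (T.price_nonneg i j) measureReal_nonneg)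

/-- Income from the entry fees alone, if every item is rarely in demand: then each item is
available with probability at least `1 / 2` at the turn of every buyer. -/
theorem sum_fee_le_revenue (h : ∀ j, ∑ i, (D i j).real (Ici (T.price i j)) ≤ 1 / 2) :
    ∑ i, T.fee i * (Measure.pi (D i)).real
      {t | T.fee i ≤ 1 / 2 * ∑ j, max (t j - T.price i j) 0} ≤ (T.mechanism D).revenue D := by
  rw [revenue_eq]
  refine Finset.sum_le_sum fun i _ => ?_
  refine le_trans (mul_le_mul_of_nonneg_left (measureReal_mono fun t ht => ?_) (T.fee_nonneg i))
    (le_add_of_nonneg_right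
      (Finset.sum_nonneg fun j _ => mul_nonneg (T.price_nonneg i j) measureReal_nonneg))
  rw [mem_ofPred_eq, Participates, T.expectedGain_eq D i (T.measurableSet_mem_available D i), sub_nonneg]
  refine le_trans (show T.fee i ≤ 1 / 2 * ∑ j, max (t j - T.price i j) 0 from ht) ?_
  rw [Finset.mul_sum]
  exact Finset.sum_le_sum fun j _ =>
    mul_le_mul_of_nonneg_right (T.half_le_available D (h j) i) (le_max_right _ _)

/-- Without entry fees, everybody participates, and the revenue from the items is additive. -/
theorem revenue_eq_of_fee_eq_zero (h : ∀ i, T.fee i = 0) : (T.mechanism D).revenue D =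
    ∑ j, ∑ i, T.price i j * ((jointLaw D).real {v | j ∈ T.available D i v} *
      (D i j).real (Ici (T.price i j))) := by
  rw [revenue_eq, Finset.sum_comm]
  refine Finset.sum_congr rfl fun i _ => ?_
  rw [h i, zero_mul, zero_add]
  refine Finset.sum_congr rfl fun j _ => ?_
  rw [← T.measureReal_available_inter D]
  congr 2
  ext v
  simp only [mem_purchase, mem_ofPred_eq, mem_inter_iff, and_iff_right_iff_imp]
  intro _
  simp only [Participates, h i, sub_zero, T.expectedGain_eq D i (T.measurableSet_mem_available D i)]
  exact Finset.sum_nonneg fun j _ => mul_nonneg measureReal_nonneg (le_max_right _ _)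

/-- A prophet inequality for posted prices: if buyer `i` would buy item `j` at the price `r i j`
with probability at least `s i j`, and no item is oversold by the `s i j` on average, then some
sequential posted prices earn half of `∑ i j, r i j * s i j`. All prices for an item are
raised to at least one half of its share in this sum. -/
theorem exists_posted_prices {r s : Fin n → Fin m → ℝ} (hr : ∀ i j, 0 ≤ r i j)
    (hs0 : ∀ i j, 0 ≤ s i j) (hs : ∀ i j, s i j ≤ (D i j).real (Ici (r i j)))
    (hsum : ∀ j, ∑ i, s i j ≤ 1) :
    ∃ T : SeqTwoPartTariff n m,
      1 / 2 * ∑ j, ∑ i, r i j * s i j ≤ (T.mechanism D).revenue D := by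
  set τ : Fin m → ℝ := fun j => 1 / 2 * ∑ i, r i j * s i j with hτ
  have hτ0 : ∀ j, 0 ≤ τ j := fun j =>
    mul_nonneg (by norm_num) (Finset.sum_nonneg fun i _ => mul_nonneg (hr i j) (hs0 i j))
  let T : SeqTwoPartTariff n m :=
    { order := 1
      fee := fun _ => 0
      price := fun i j => max (r i j) (τ j)
      fee_nonneg := fun _ => le_rfl
      price_nonneg := fun i j => le_max_of_le_left (hr i j) }
  refine ⟨T, ?_⟩
  rw [T.revenue_eq_of_fee_eq_zero D fun _ => rfl, Finset.mul_sum]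
  refine Finset.sum_le_sum fun j _ => ?_
  set a : Fin n → ℝ := fun i => (jointLaw D).real {v | j ∈ T.available D i v} with ha
  set q : Fin n → ℝ := fun i => (D i j).real (Ici (T.price i j)) with hq
  set U : ℝ := (jointLaw D).real {v | j ∈ T.remaining D n v} with hU
  have hU0 : 0 ≤ U := measureReal_nonneg
  have hsold : 1 - U ≤ ∑ i, a i * q i := T.one_sub_remaining_le D n j
  have hUa : ∀ i, U ≤ a i := fun i => measureReal_mono fun v hv =>
    T.remaining_antitone D v (T.order.symm i).isLt.le hv
  have hterm : ∀ i, U * ((r i j - τ j) * s i j) ≤ (T.price i j - τ j) * (a i * q i) := by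
    intro i
    have hq0 : 0 ≤ q i := measureReal_nonneg
    have ha0 : 0 ≤ a i := measureReal_nonneg
    rcases le_total (r i j) (τ j) with h | h
    · have hp : T.price i j = τ j := max_eq_right h
      rw [hp, sub_self, zero_mul]
      exact mul_nonpos_of_nonneg_of_nonpos hU0
        (mul_nonpos_of_nonpos_of_nonneg (sub_nonpos.2 h) (hs0 i j))
    · have hp : T.price i j = r i j := max_eq_left h
      have h1 : s i j ≤ q i := by
        simp only [hq, hp]
        exact hs i j
      calc U * ((r i j - τ j) * s i j) = (r i j - τ j) * (U * s i j) := by ring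
        _ ≤ (r i j - τ j) * (a i * q i) :=
          mul_le_mul_of_nonneg_left (mul_le_mul (hUa i) h1 (hs0 i j) ha0) (sub_nonneg.2 h)
        _ = _ := by rw [hp]
  have hsumτ : τ j ≤ ∑ i, (r i j - τ j) * s i j := by
    have h1 : ∑ i, (r i j - τ j) * s i j = 2 * τ j - τ j * ∑ i, s i j := by
      simp only [sub_mul, Finset.sum_sub_distrib, ← Finset.mul_sum]
      rw [hτ]
      ring
    have := mul_le_of_le_one_right (hτ0 j) (hsum j)
    linarith
  calc 1 / 2 * ∑ i, r i j * s i j = τ j * (1 - U) + U * τ j := by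
        rw [hτ]
        ring
    _ ≤ τ j * ∑ i, a i * q i + U * ∑ i, (r i j - τ j) * s i j :=
        add_le_add (mul_le_mul_of_nonneg_left hsold (hτ0 j)) (mul_le_mul_of_nonneg_left hsumτ hU0)
    _ = ∑ i, (τ j * (a i * q i) + U * ((r i j - τ j) * s i j)) := by
        rw [Finset.mul_sum, Finset.mul_sum, Finset.sum_add_distrib]
    _ ≤ ∑ i, T.price i j * (a i * q i) := by
        refine Finset.sum_le_sum fun i _ => ?_
        linarith [hterm i, sub_mul (T.price i j) (τ j) (a i * q i)]

end SeqTwoPartTariff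

/-! ### Lower bounds on the optimal revenue -/

theorem Mechanism.allocProb_of_alloc_eq_pure {M : Mechanism n m} {v : ValueProfile n m}
    {a : Fin n → Finset (Fin m)} (h : M.alloc v = PMF.pure a) (i : Fin n) (j : Fin m) :
    M.allocProb v i j = if j ∈ a i then 1 else 0 := by
  unfold Mechanism.allocProb
  rw [h, Finset.sum_eq_single a]
  · simp
  · intro c _ hc
    simp [PMF.pure_apply, hc]
  · simp

/-- The mechanism that only offers item `j` to buyer `i`, at the price `r`. -/
def singleOffer (i : Fin n) (j : Fin m) (r : ℝ) : Mechanism n m where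
  alloc v := PMF.pure fun k => if k = i ∧ r ≤ v i j then {j} else ∅
  pay v k := if k = i ∧ r ≤ v i j then r else 0

theorem allocProb_singleOffer (i : Fin n) (j : Fin m) (r : ℝ) (v : ValueProfile n m) (k : Fin n)
    (l : Fin m) : (singleOffer i j r).allocProb v k l =
      if (k = i ∧ r ≤ v i j) ∧ l = j then 1 else 0 := by
  rw [Mechanism.allocProb_of_alloc_eq_pure (M := singleOffer i j r) rfl]
  by_cases h : k = i ∧ r ≤ v i j <;> simp [h]

theorem interimUtility_singleOffer (D : Fin n → Fin m → Measure ℝ)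
    [∀ i j, IsProbabilityMeasure (D i j)] (i : Fin n) (j : Fin m) (r : ℝ) (k : Fin n)
    (t q : Fin m → ℝ) :
    (singleOffer i j r).interimUtility D k t q = if k = i ∧ r ≤ q j then t j - r else 0 := by
  have h : ∀ v : ValueProfile n m,
      (k = i ∧ r ≤ Function.update v k q i j) ↔ (k = i ∧ r ≤ q j) := fun v => by
    constructor <;> rintro ⟨rfl, h⟩ <;> exact ⟨rfl, by simpa using h⟩
  simp only [Mechanism.interimUtility, Mechanism.interimAlloc, Mechanism.interimPay,
    allocProb_singleOffer]
  simp only [singleOffer, h]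
  by_cases hc : k = i ∧ r ≤ q j
  · simp [hc]
  · simp [hc]

/-- The revenue of a posted price for a single item is at most the optimal revenue. -/
theorem posted_price_le_optRevenue (D : Fin n → Fin m → Measure ℝ)
    [∀ i j, IsProbabilityMeasure (D i j)] (i : Fin n) (j : Fin m) (r : ℝ) :
    ((r * (D i j).real (Ici r) : ℝ) : EReal) ≤ optRevenue D := by
  have hset : MeasurableSet {v : ValueProfile n m | r ≤ v i j} :=
    measurableSet_le measurable_const ((measurable_pi_apply j).comp (measurable_pi_apply i))
  have hpaym : ∀ k, Measurable fun v => (singleOffer i j r).pay v k := fun k => by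
    simp only [singleOffer]
    exact Measurable.ite (MeasurableSet.inter (MeasurableSet.const _) hset)
      measurable_const measurable_const
  have hbound : ∀ v k, ‖(singleOffer i j r).pay v k‖ ≤ |r| := fun v k => by
    simp only [singleOffer]
    split_ifs <;> simp
  have hrev : (singleOffer i j r).revenue D = r * (D i j).real (Ici r) := by
    have h : ∀ v : ValueProfile n m, ∑ k, (singleOffer i j r).pay v k =
        {v : ValueProfile n m | r ≤ v i j}.indicator (fun _ => r) v := fun v => by
      simp only [singleOffer]
      rw [Finset.sum_eq_single i]
      · simp [indicator]
      · intro k _ hk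
        simp [hk]
      · simp
    unfold Mechanism.revenue
    simp_rw [h]
    rw [integral_indicator_const _ hset, jointLaw_real_Ici, smul_eq_mul, mul_comm]
  rw [← hrev]
  refine le_iSup₂_of_le (singleOffer i j r) ⟨⟨?_, hpaym, ?_, ?_⟩, ?_, ?_, ?_⟩ le_rfl
  · intro k l
    simp only [allocProb_singleOffer]
    exact Measurable.ite ((MeasurableSet.inter (MeasurableSet.const _) hset).inter
      (MeasurableSet.const _)) measurable_const measurable_const
  · exact fun k => Integrable.of_bound (hpaym k).aestronglyMeasurable |r|
      (Eventually.of_forall fun v => hbound v k)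
  · refine fun k t _ => Integrable.of_bound ((hpaym k).comp ?_).aestronglyMeasurable |r|
      (Eventually.of_forall fun v => hbound _ k)
    fun_prop
  · intro v a ha k₁ k₂ hne
    simp only [singleOffer, PMF.support_pure, mem_singleton_iff] at ha
    subst ha
    by_cases h1 : k₁ = i
    · have h2 : k₂ ≠ i := fun h => hne (h1.trans h.symm)
      simp [h2]
    · simp [h1]
  · intro k t _ q _
    rw [interimUtility_singleOffer, interimUtility_singleOffer]
    split_ifs with h1 h2 h2
    · exact le_rfl
    · have := lt_of_not_ge fun h => h2 ⟨h1.1, h⟩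
      linarith
    · linarith [h2.2]
    · exact le_rfl
  · intro k t _
    rw [interimUtility_singleOffer]
    split_ifs with h
    · linarith [h.2]
    · exact le_rfl

/-! ### Interim quantities of a mechanism -/

namespace Mechanism

theorem allocProb_nonneg (M : Mechanism n m) (v : ValueProfile n m) (i : Fin n) (j : Fin m) :
    0 ≤ M.allocProb v i j :=
  Finset.sum_nonneg fun a _ => by split_ifs <;> simp

theorem sum_alloc_toReal (M : Mechanism n m) (v : ValueProfile n m) :
    ∑ a, (M.alloc v a).toReal = 1 := by
  rw [← ENNReal.toReal_sum fun a _ => PMF.apply_ne_top _ _, ← tsum_fintype (L := .unconditional _),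
    PMF.tsum_coe, ENNReal.toReal_one]

theorem sum_allocProb_le_one {M : Mechanism n m} (hM : M.SupplyFeasible) (v : ValueProfile n m)
    (j : Fin m) : ∑ i, M.allocProb v i j ≤ 1 := by
  unfold allocProb
  rw [Finset.sum_comm, ← M.sum_alloc_toReal v]
  refine Finset.sum_le_sum fun a _ => ?_
  by_cases ha : a ∈ (M.alloc v).support
  · by_cases hj : ∃ i, j ∈ a i
    · obtain ⟨i, hi⟩ := hj
      rw [Finset.sum_eq_single i]
      · simp [hi]
      · intro k _ hk
        rw [if_neg]
        exact fun h => Finset.disjoint_left.1 (hM v a ha k i hk) h hi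
      · simp
    · push Not at hj
      simp [hj]
  · have : M.alloc v a = 0 := by simpa [PMF.mem_support_iff] using ha
    simp [this]

theorem allocProb_le_one (M : Mechanism n m) (v : ValueProfile n m) (i : Fin n) (j : Fin m) :
    M.allocProb v i j ≤ 1 := by
  rw [← M.sum_alloc_toReal v]
  exact Finset.sum_le_sum fun a _ => by split_ifs <;> simp

end Mechanism

theorem ae_mem_typeSpace (D : Fin n → Fin m → Measure ℝ) [∀ i j, IsProbabilityMeasure (D i j)]
    (i : Fin n) : ∀ᵐ t ∂Measure.pi (D i), t ∈ typeSpace D i :=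
  ae_all_iff.2 fun j =>
    (measurePreserving_eval (D i) j).quasiMeasurePreserving.ae Measure.support_mem_ae

/-- The revenue is a sum over the buyers; the bound for a single buyer applies to the interim
allocation and payment of each of them. -/
theorem revenue_le_sum (D : Fin n → Fin m → Measure ℝ) [∀ i j, IsProbabilityMeasure (D i j)]
    {M : Mechanism n m} (hW : M.WellDefined D) (hB : M.BIC D) (hI : M.InterimIR D)
    {b R : Fin n → Fin m → ℝ} (hb : ∀ i j, 0 ≤ b i j) (hR0 : ∀ i j, 0 ≤ R i j)
    (hR : ∀ i j r, b i j < r → (r - b i j) * (D i j).real (Ici r) ≤ R i j) :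
    M.revenue D ≤ ∑ i, (∑ j, b i j * ∫ v, M.allocProb v i j ∂jointLaw D + 2 * ∑ j, R i j +
      ∑ j, ∫ z, core (b i j) (∑ k, R i k) z ∂D i j) := by
  unfold Mechanism.revenue
  rw [integral_finsetSum _ fun i _ => hW.integrable_pay i]
  refine Finset.sum_le_sum fun i _ => ?_
  have hup : Measurable fun q : (Fin m → ℝ) × ValueProfile n m => Function.update q.2 i q.1 :=
    (measurePreserving_update (fun i => Measure.pi (D i)) i).measurable
  have hint : ∀ j, Integrable (fun v => M.allocProb v i j) (jointLaw D) := fun j =>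
    Integrable.of_bound (hW.measurable_alloc i j).aestronglyMeasurable 1
      (Eventually.of_forall fun v => by
        rw [Real.norm_of_nonneg (M.allocProb_nonneg v i j)]
        exact M.allocProb_le_one v i j)
  have hpay : ∫ v, M.pay v i ∂jointLaw D = ∫ t, M.interimPay D i t ∂Measure.pi (D i) :=
    (integral_update (fun i => Measure.pi (D i)) i (hW.measurable_pay i)
      (hW.integrable_pay i)).2
  have halloc : ∀ j, ∫ v, M.allocProb v i j ∂jointLaw D =
      ∫ t, M.interimAlloc D i t j ∂Measure.pi (D i) := fun j =>
    (integral_update (fun i => Measure.pi (D i)) i (hW.measurable_alloc i j) (hint j)).2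
  simp_rw [halloc]
  rw [hpay]
  refine single_buyer_bound (D i) (ae_mem_typeSpace D i) (x := M.interimAlloc D i)
    (p := M.interimPay D i) ?_ ?_ ?_ ?_ ?_ ?_ (hb i) (hR0 i) (hR i)
  · intro j
    exact ((hW.measurable_alloc i j).comp hup).stronglyMeasurable.integral_prod_right'.measurable
  · exact ((hW.measurable_pay i).comp hup).stronglyMeasurable.integral_prod_right'.measurable
  · exact fun t j => integral_nonneg fun v => M.allocProb_nonneg _ i j
  · intro t j
    refine (integral_mono_of_nonneg (Eventually.of_forall fun v => M.allocProb_nonneg _ i j)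
      (integrable_const 1) (Eventually.of_forall fun v => M.allocProb_le_one _ i j)).trans ?_
    simp
  · exact hB i
  · exact hI i

/-! ### Comparison with sequential two-part tariffs -/

/-- Every truthful mechanism earns at most `20` times as much as some sequential two-part tariff,
up to an arbitrarily small error. The tariff is one of three: posted prices at quantiles of the
values, posted prices above the quantiles, or entry fees with prices at the quantiles. -/
theorem exists_tariff_revenue_le (D : Fin n → Fin m → Measure ℝ)
    [∀ i j, IsProbabilityMeasure (D i j)] (hnonneg : ∀ i j, ∀ᵐ x ∂(D i j), 0 ≤ x) {K : ℝ}
    (hK : ∀ i j r, r * (D i j).real (Ici r) ≤ K) {M : Mechanism n m}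
    (hW : M.WellDefined D) (hF : M.SupplyFeasible) (hB : M.BIC D) (hI : M.InterimIR D)
    {ε : ℝ} (hε : 0 < ε) :
    ∃ T : SeqTwoPartTariff n m, M.revenue D ≤ 20 * (T.mechanism D).revenue D + ε := by
  set q : Fin n → Fin m → ℝ := fun i j => ∫ v, M.allocProb v i j ∂jointLaw D with hq
  have hint : ∀ i j, Integrable (fun v => M.allocProb v i j) (jointLaw D) := fun i j =>
    Integrable.of_bound (hW.measurable_alloc i j).aestronglyMeasurable 1
      (Eventually.of_forall fun v => by
        rw [Real.norm_of_nonneg (M.allocProb_nonneg v i j)]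
        exact M.allocProb_le_one v i j)
  have hq0 : ∀ i j, 0 ≤ q i j := fun i j => integral_nonneg fun v => M.allocProb_nonneg v i j
  have hqsum : ∀ j, ∑ i, q i j ≤ 1 := fun j => by
    simp only [hq]
    rw [← integral_finsetSum _ fun i _ => hint i j]
    refine (integral_mono (integrable_finsetSum _ fun i _ => hint i j) (integrable_const 1)
      fun v => M.sum_allocProb_le_one hF v j).trans ?_
    simp
  have hq1 : ∀ i j, q i j ≤ 1 := fun i j =>
    (Finset.single_le_sum (f := fun i => q i j) (fun i _ => hq0 i j)
      (Finset.mem_univ i)).trans (hqsum j)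
  -- The summand `1 / n` keeps the quantile level positive for buyers who never get the item.
  set s : Fin n → Fin m → ℝ := fun i j => (q i j + 1 / n) / 4 with hs
  have hn : ∀ _ : Fin n, (0 : ℝ) < 1 / n ∧ (1 : ℝ) / n ≤ 1 := fun i => by
    have h1 : 1 ≤ n := i.pos
    have h2 : (1 : ℝ) ≤ n := by exact_mod_cast h1
    exact ⟨by positivity, by rw [div_le_one (by linarith)]; exact h2⟩
  have hs0 : ∀ i j, 0 < s i j := fun i j => by
    have := (hn i).1
    have := hq0 i j
    simp only [hs]
    positivity
  have hs1 : ∀ i j, s i j ≤ 1 := fun i j => by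
    have := (hn i).2
    have := hq1 i j
    simp only [hs]
    linarith
  have hssum : ∀ j, ∑ i, s i j ≤ 1 / 2 := fun j => by
    have h1 : ∑ _i : Fin n, (1 : ℝ) / n ≤ 1 := by
      rw [Finset.sum_const, Finset.card_univ, Fintype.card_fin, nsmul_eq_mul, mul_one_div]
      exact div_self_le_one _
    simp only [hs]
    rw [← Finset.sum_div, Finset.sum_add_distrib]
    linarith [hqsum j]
  choose b hb0 hbs hsb using fun i j => exists_quantile (D i j) (hnonneg i j) (hs0 i j) (hs1 i j)
  have hIci : ∀ i j r, b i j < r → (D i j).real (Ici r) ≤ s i j := fun i j r hr =>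
    (measureReal_mono (Ici_subset_Ioi.2 hr)).trans (hbs i j)
  -- `R i j` is the best revenue above the base price from selling item `j` to buyer `i` alone.
  set R : Fin n → Fin m → ℝ := fun i j =>
    ⨆ r : Ioi (b i j), ((r : ℝ) - b i j) * (D i j).real (Ici (r : ℝ)) with hRdef
  have hRb : ∀ i j, BddAbove (range fun r : Ioi (b i j) =>
      ((r : ℝ) - b i j) * (D i j).real (Ici (r : ℝ))) := by
    refine fun i j => ⟨K, ?_⟩
    rintro _ ⟨r, rfl⟩
    refine le_trans ?_ (hK i j r)
    exact mul_le_mul_of_nonneg_right (by linarith [hb0 i j]) measureReal_nonneg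
  have hR0 : ∀ i j, 0 ≤ R i j := fun i j => Real.iSup_nonneg fun r =>
    mul_nonneg (sub_nonneg.2 (le_of_lt r.2)) measureReal_nonneg
  have hR : ∀ i j r, b i j < r → (r - b i j) * (D i j).real (Ici r) ≤ R i j := fun i j r hr =>
    le_ciSup (hRb i j) ⟨r, hr⟩
  set N : ℝ := (n : ℝ) * m with hN
  have hN0 : 0 ≤ N := by positivity
  set δ : ℝ := ε / (5 * N + 1) with hδ
  have hδ0 : 0 < δ := by positivity
  have hδN : 5 * (N * δ) ≤ ε := by
    have : δ * (5 * N + 1) = ε := div_mul_cancel₀ _ (by positivity)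
    nlinarith
  have hr : ∀ i j, ∃ r, b i j < r ∧ R i j - δ ≤ (r - b i j) * (D i j).real (Ici r) := by
    intro i j
    have : Nonempty (Ioi (b i j)) := ⟨⟨b i j + 1, by simp⟩⟩
    obtain ⟨r, hr⟩ := exists_lt_of_lt_ciSup (sub_lt_self (R i j) hδ0)
    exact ⟨r, r.2, hr.le⟩
  choose r hbr hRr using hr
  -- The three candidate tariffs.
  obtain ⟨T₁, hT₁⟩ := SeqTwoPartTariff.exists_posted_prices D hb0 (fun i j => (hs0 i j).le) hsb
    (fun j => (hssum j).trans (by norm_num))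
  obtain ⟨T₂, hT₂⟩ := SeqTwoPartTariff.exists_posted_prices D (r := r)
    (s := fun i j => (D i j).real (Ici (r i j)))
    (fun i j => (hb0 i j).trans (hbr i j).le) (fun i j => measureReal_nonneg) (fun i j => le_rfl)
    (fun j => (Finset.sum_le_sum fun i _ => hIci i j _ (hbr i j)).trans
      ((hssum j).trans (by norm_num)))
  set Rt : Fin n → ℝ := fun i => ∑ j, R i j with hRt
  set C : Fin n → ℝ := fun i => ∑ j, ∫ z, core (b i j) (Rt i) z ∂D i j with hC
  let T₃ : SeqTwoPartTariff n m :=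
    { order := 1
      fee := fun i => max 0 (1 / 2 * (C i - 2 * Rt i - m * δ))
      price := fun i j => b i j + δ
      fee_nonneg := fun i => le_max_left _ _
      price_nonneg := fun i j => add_nonneg (hb0 i j) hδ0.le }
  have hT₃ : ∑ i, 1 / 4 * (C i - 2 * Rt i - m * δ) ≤ (T₃.mechanism D).revenue D := by
    refine le_trans (Finset.sum_le_sum fun i _ => ?_) (T₃.sum_fee_le_revenue D fun j =>
      (Finset.sum_le_sum fun i _ => hIci i j _ (lt_add_of_pos_right _ hδ0)).trans (hssum j))
    rcases le_total (C i - 2 * Rt i - m * δ) 0 with h | h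
    · exact le_trans (by linarith) (mul_nonneg (T₃.fee_nonneg i) measureReal_nonneg)
    · have hfee : T₃.fee i = 1 / 2 * (C i - 2 * Rt i - m * δ) := max_eq_right (by linarith)
      have hprob : 1 / 2 ≤ (Measure.pi (D i)).real
          {t | T₃.fee i ≤ 1 / 2 * ∑ j, max (t j - T₃.price i j) 0} := by
        refine (core_concentration (D i) (hR0 i) (hR i)).trans (measureReal_mono fun t ht => ?_)
        have ht' : C i - 2 * Rt i ≤ ∑ j, core (b i j) (Rt i) (t j) := ht
        have hsum : ∑ j, core (b i j) (Rt i) (t j) ≤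
            ∑ j, max (t j - T₃.price i j) 0 + m * δ := by
          have : (m : ℝ) * δ = ∑ _j : Fin m, δ := by simp
          rw [this, ← Finset.sum_add_distrib]
          refine Finset.sum_le_sum fun j _ => (core_le_surplus _ _ _).trans ?_
          change max (t j - b i j) 0 ≤ max (t j - (b i j + δ)) 0 + δ
          refine max_le ?_ ?_
          · linarith [le_max_left (t j - (b i j + δ)) 0]
          · linarith [le_max_right (t j - (b i j + δ)) 0]
        rw [mem_ofPred_eq, hfee]
        linarith
      calc 1 / 4 * (C i - 2 * Rt i - m * δ) = T₃.fee i * (1 / 2) := by rw [hfee]; ring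
        _ ≤ _ := mul_le_mul_of_nonneg_left hprob (T₃.fee_nonneg i)
  -- The upper bound for `M`, expressed through the revenues of the three tariffs.
  have hM := revenue_le_sum D hW hB hI hb0 hR0 hR
  have h1 : ∑ i, ∑ j, b i j * q i j ≤ 4 * ∑ j, ∑ i, b i j * s i j := by
    rw [Finset.sum_comm, Finset.mul_sum]
    refine Finset.sum_le_sum fun j _ => ?_
    rw [Finset.mul_sum]
    refine Finset.sum_le_sum fun i _ => ?_
    have h4 : q i j ≤ 4 * s i j := by
      simp only [hs]
      linarith [(hn i).1]
    linarith [mul_le_mul_of_nonneg_left h4 (hb0 i j)]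
  have h2 : ∑ i, Rt i ≤ ∑ j, ∑ i, r i j * (D i j).real (Ici (r i j)) + N * δ := by
    have : N * δ = ∑ _j : Fin m, ∑ _i : Fin n, δ := by
      simp [hN]
      ring
    rw [this, hRt, Finset.sum_comm, ← Finset.sum_add_distrib]
    refine Finset.sum_le_sum fun j _ => ?_
    rw [← Finset.sum_add_distrib]
    refine Finset.sum_le_sum fun i _ => ?_
    have h3 : (r i j - b i j) * (D i j).real (Ici (r i j)) ≤
        r i j * (D i j).real (Ici (r i j)) :=
      mul_le_mul_of_nonneg_right (by linarith [hb0 i j]) measureReal_nonneg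
    linarith [hRr i j]
  have h3 : ∑ i, C i ≤ 2 * ∑ i, Rt i + N * δ + 4 * (T₃.mechanism D).revenue D := by
    have : ∑ i, 1 / 4 * (C i - 2 * Rt i - m * δ) =
        1 / 4 * (∑ i, C i - 2 * ∑ i, Rt i - N * δ) := by
      rw [← Finset.mul_sum, Finset.sum_sub_distrib, Finset.sum_sub_distrib, ← Finset.mul_sum]
      simp [hN]
      ring
    linarith
  have hM' : M.revenue D ≤ ∑ i, ∑ j, b i j * q i j + 2 * ∑ i, Rt i + ∑ i, C i := by
    refine hM.trans_eq ?_
    rw [Finset.sum_add_distrib, Finset.sum_add_distrib, ← Finset.mul_sum]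
  have htotal : M.revenue D ≤ 8 * (T₁.mechanism D).revenue D + 8 * (T₂.mechanism D).revenue D +
      4 * (T₃.mechanism D).revenue D + ε := by
    linarith
  obtain ⟨T, hT⟩ := Finite.exists_max
    (fun k : Fin 3 => ((![T₁, T₂, T₃] k).mechanism D).revenue D)
  refine ⟨![T₁, T₂, T₃] T, ?_⟩
  have e1 := hT 0
  have e2 := hT 1
  have e3 := hT 2
  simp only [Matrix.cons_val_zero, Matrix.cons_val_one, Matrix.cons_val] at e1 e2 e3
  linarith

end Auction

end

theorem mainTheorem6 (n m : ℕ) (D : Fin n → Fin m → MeasureTheory.Measure ℝ)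
    (hprob : ∀ i j, MeasureTheory.IsProbabilityMeasure (D i j))
    (hnonneg : ∀ i j, ∀ᵐ x ∂(D i j), 0 ≤ x)
    (hfin : Auction.optRevenue D ≠ ⊤) :
    ∃ T : Auction.SeqTwoPartTariff n m,
      (T.mechanism D).SupplyFeasible ∧
      Auction.optRevenue D ≤ ((28 * (T.mechanism D).revenue D : ℝ) : EReal) := by
  suffices h : ∃ T : Auction.SeqTwoPartTariff n m,
      Auction.optRevenue D ≤ ((28 * (T.mechanism D).revenue D : ℝ) : EReal) by
    obtain ⟨T, hT⟩ := h
    exact ⟨T, T.supplyFeasible_mechanism D, hT⟩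
  rcases le_or_gt (Auction.optRevenue D) 0 with h0 | h0
  · let T : Auction.SeqTwoPartTariff n m :=
      { order := 1
        fee := fun _ => 0
        price := fun _ _ => 0
        fee_nonneg := fun _ => le_rfl
        price_nonneg := fun _ _ => le_rfl }
    refine ⟨T, h0.trans ?_⟩
    have := T.revenue_nonneg D
    exact_mod_cast (by positivity : 0 ≤ 28 * (T.mechanism D).revenue D)
  · obtain ⟨V, hV⟩ : ∃ V : ℝ, (V : EReal) = Auction.optRevenue D :=
      ⟨_, EReal.coe_toReal hfin (ne_bot_of_gt h0)⟩
    have hV0 : 0 < V := by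
      rw [← hV] at h0
      exact_mod_cast h0
    have hlt : ((9 / 10 * V : ℝ) : EReal) < Auction.optRevenue D := by
      rw [← hV]
      exact_mod_cast (by linarith : 9 / 10 * V < V)
    unfold Auction.optRevenue at hlt
    simp only [lt_iSup_iff] at hlt
    obtain ⟨M, ⟨hW, hF, hB, hI⟩, hM⟩ := hlt
    have hM' : 9 / 10 * V < M.revenue D := by exact_mod_cast hM
    obtain ⟨T, hT⟩ := Auction.exists_tariff_revenue_le D hnonneg (K := V) (fun i j r => by
      have := Auction.posted_price_le_optRevenue D i j r
      rw [← hV] at this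
      exact_mod_cast this) hW hF hB hI (ε := V / 10) (by positivity)
    refine ⟨T, ?_⟩
    rw [← hV]
    exact_mod_cast (by linarith : V ≤ 28 * (T.mechanism D).revenue D)
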